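/- Let $\mathcal A=\{a_i: i\ge 1\}$ be a countably infinite alphabet of distinct letters, and let $X_1,X_2,\dots$ be independent random variables with values in $\mathcal A$ and common distribution $p_i=\mathbb P(X_k=a_i)$, $i\ge1$ (some $p_i$ may be $0$). Assume that the distribution is nonuniform, i.e. that the nonzero $p_i$ are not all equal. Write $p(a_i)=p_i$, $0\ln 0=0$, $H=-\sum_{i\ge1}p_i\ln p_i$ and $\sigma^2=\operatorname{Var}(\ln p(X_1))$. For $n\ge1$ let $Y_i=\#\{k\le n: X_k=a_i\}$, $\hat p_i=Y_i/n$, $\hat H_n=-\sum_{i\ge1}\hat p_i\ln\hat p_i$, let $\hat m=\sum_{i\ge1}\mathbf 1_{\{Y_i>0\}}$ be the number of distinct letters observed, and let $$\hat H_{MM}=\hat H_n+\frac{\hat m-1}{2n}$$ be the Miller–Madow estimator. Let $0<\delta<\tfrac12$ and assume that $\mathbb E|\ln p(X_1)|^{2+\delta}<\infty$ and that there are an integer-valued function $K(n)$ and a constant $C$ such that, for all $n\ge1$, $$K(n)\le n^{\frac12-\delta},\qquad n^{\frac12+\delta}\ln n\sum_{i\ge K(n)}p_i\le C,\qquad -n^{\frac12+\delta}\sum_{i\ge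 K(n)}p_i\ln p_i\le C,$$ the sums being over the integers $i\ge1$ with $i\ge K(n)$. Then there is a constant $C'$, not depending on $n$, such that for all $n\ge1$ $$\sup_{x\in\mathbb R}\left|\mathbb P\left(\frac{\sqrt n\,(\hat H_{MM}-H)}{\sigma}<x\right)-\Phi(x)\right|\le C'n^{-\delta/2},$$ where $\Phi$ is the standard normal distribution function. -/

import Mathlib

open MeasureTheory ProbabilityTheory

namespace MillerMadow

noncomputable section

/-- Shannon's entropy `H = -∑ pᵢ ln pᵢ`, natural logarithm, `0 ln 0 = 0`. -/
def entropy (p : ℕ+ → ℝ) : ℝ := -∑' i, p i * Real.log (p i)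

/-- A distribution is nonuniform if its nonzero probabilities are not all equal
(in particular, a point mass and the uniform law on a finite set of letters are excluded). -/
def Nonuniform (p : ℕ+ → ℝ) : Prop := ∃ i j, 0 < p i ∧ 0 < p j ∧ p i ≠ p j

/-- The tail sum `∑_{i ≥ k} f i` over positive integers `i`. -/
def tailSum (f : ℕ+ → ℝ) (k : ℤ) : ℝ := ∑' i : ℕ+, if k ≤ ((i : ℕ) : ℤ) then f i else 0

variable {Ω α : Type*}

open Classical in
/-- The count `Y_i` of the letter `b` among the first `n` observations `X 0, …, X (n - 1)`. -/
def count (X : ℕ → Ω → α) (n : ℕ) (b : α) (ω : Ω) : ℕ :=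
  ∑ k ∈ Finset.range n, if X k ω = b then 1 else 0

/-- The sample proportion of the letter `b` among the first `n` observations. -/
def phat (X : ℕ → Ω → α) (n : ℕ) (b : α) (ω : Ω) : ℝ := (count X n b ω : ℝ) / n

/-- The number of distinct letters observed, `∑ᵢ 1{Yᵢ > 0}`, the alphabet being enumerated
by `a`; only finitely many terms are nonzero. -/
def mhat (a : ℕ+ ≃ α) (X : ℕ → Ω → α) (n : ℕ) (ω : Ω) : ℕ :=
  ∑' i : ℕ+, if 0 < count X n (a i) ω then 1 else 0

/-- The plug-in estimator of the entropy: the entropy of the empirical distribution. -/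
def plugIn (a : ℕ+ ≃ α) (X : ℕ → Ω → α) (n : ℕ) (ω : Ω) : ℝ :=
  entropy fun i => phat X n (a i) ω

/-- The Miller–Madow estimator `Ĥ_n + (m̂ - 1) / (2 n)`. -/
def estimator (a : ℕ+ ≃ α) (X : ℕ → Ω → α) (n : ℕ) (ω : Ω) : ℝ :=
  plugIn a X n ω + ((mhat a X n ω : ℝ) - 1) / (2 * n)

/-- The random variable `ln p(X_{k+1})`, where `p(aᵢ) = pᵢ`. -/
def logp (a : ℕ+ ≃ α) (p : ℕ+ → ℝ) (X : ℕ → Ω → α) (k : ℕ) (ω : Ω) : ℝ :=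
  Real.log (p (a.symm (X k ω)))

/-- The standard normal distribution function. -/
def Phi (x : ℝ) : ℝ := cdf (gaussianReal 0 1) x

end

end MillerMadow

/-!
Summing the Kullback–Leibler divergence letter by letter gives, almost surely,
`Ĥ_MM - H = n⁻¹ ∑ₖ (-ln p(Xₖ) - H) - KL(p̂ ‖ p) + (m̂ - 1) / (2 n)`.
The first term is a centred sample mean, for which a Berry–Esseen bound of order `n ^ (-δ / 2)`
holds under the moment condition. The other two are of order `n ^ (-1 / 2 - δ)` in mean: in
expectation a letter contributes at most `1 / n` to either of them, which is used below `K n`, and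
beyond `K n` at most its entropy `-pᵢ ln pᵢ`, respectively its probability `pᵢ`. For a nonuniform
law the probabilities are bounded away from `1`, so `pᵢ` is at most a constant times `-pᵢ ln pᵢ`,
and the entropy tail controls both. Markov's inequality, with the Lipschitz continuity of `Φ`, then
transfers the Berry–Esseen bound to the estimator.

For the Berry–Esseen bound, the characteristic functions are compared for `|t| ≤ c √n`; smoothing
with a Gaussian of standard deviation `n ^ (-δ / 2)` makes the higher frequencies negligible.
-/

namespace MillerMadow

open scoped NNReal ENNReal

section CharFun

variable {δ A : ℝ}

lemma pow_three_le_rpow_two_add (hδ₀ : 0 ≤ δ) (hδ₁ : δ ≤ 1) {y : ℝ} (hy₀ : 0 ≤ y) (hy₁ : y ≤ 1) :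
    y ^ 3 ≤ y ^ (2 + δ) := by
  rw [← Real.rpow_natCast]
  exact Real.rpow_le_rpow_of_exponent_ge' hy₀ hy₁ (by linarith) (by push_cast; linarith)

lemma norm_cexp_mul_I_sub_taylor_le (hδ₀ : 0 ≤ δ) (hδ₁ : δ ≤ 1) (x : ℝ) :
    ‖Complex.exp (x * Complex.I) - (1 + x * Complex.I - x ^ 2 / 2)‖ ≤ 4 * |x| ^ (2 + δ) := by
  rcases le_total |x| 1 with hx | hx
  · have hnorm : ‖(x * Complex.I : ℂ)‖ = |x| := by simp
    have hbound := Complex.exp_bound (x := x * Complex.I) (hnorm.trans_le hx) (n := 3) three_pos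
    have hsum : ∑ m ∈ Finset.range 3, (x * Complex.I : ℂ) ^ m / (m.factorial : ℂ)
        = 1 + x * Complex.I - x ^ 2 / 2 := by
      simp only [Finset.sum_range_succ, Finset.sum_range_zero, Nat.factorial, mul_pow, Complex.I_sq]
      push_cast
      ring
    rw [hsum, hnorm] at hbound
    refine hbound.trans ?_
    have := pow_three_le_rpow_two_add hδ₀ hδ₁ (abs_nonneg x) hx
    norm_num [Nat.factorial]
    linarith [pow_nonneg (abs_nonneg x) 3]
  · have hsq : |x| ^ 2 ≤ |x| ^ (2 + δ) := by
      rw [← Real.rpow_natCast]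
      exact Real.rpow_le_rpow_of_exponent_le hx (by push_cast; linarith)
    calc ‖Complex.exp (x * Complex.I) - (1 + x * Complex.I - x ^ 2 / 2)‖
        ≤ ‖Complex.exp (x * Complex.I)‖ + (‖(1 : ℂ)‖ + ‖x * Complex.I‖ + ‖(x ^ 2 / 2 : ℂ)‖) :=
          (norm_sub_le _ _).trans (by gcongr; exact (norm_sub_le _ _).trans (by
            gcongr; exact norm_add_le _ _))
      _ = 1 + (1 + |x| + |x| ^ 2 / 2) := by simp [Complex.norm_exp_ofReal_mul_I]
      _ ≤ 4 * |x| ^ (2 + δ) := by nlinarith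

lemma integrable_rpow_abs_two_add (hδ : 0 ≤ δ) {μ : Measure ℝ}
    (hμ : MemLp id (ENNReal.ofReal (2 + δ)) μ) : Integrable (fun x => |x| ^ (2 + δ)) μ := by
  simpa [ENNReal.toReal_ofReal (by linarith : 0 ≤ 2 + δ)] using
    hμ.integrable_norm_rpow (by simp; linarith) ENNReal.ofReal_ne_top

lemma norm_charFun_sub_taylor_le (hδ₀ : 0 ≤ δ) (hδ₁ : δ ≤ 1) {μ : Measure ℝ}
    [IsProbabilityMeasure μ] (hμ : MemLp id (ENNReal.ofReal (2 + δ)) μ) (t : ℝ) :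
    ‖charFun μ t - (1 + t * (∫ x, x ∂μ : ℝ) * Complex.I - t ^ 2 / 2 * (∫ x, x ^ 2 ∂μ : ℝ))‖
      ≤ 4 * (∫ x, |x| ^ (2 + δ) ∂μ) * |t| ^ (2 + δ) := by
  have hmem : MemLp id 2 μ := hμ.mono_exponent
    (ENNReal.ofReal_ofNat 2 ▸ ENNReal.ofReal_le_ofReal (by linarith))
  have hint₁ : Integrable (fun x : ℝ => t * (x : ℂ) * Complex.I) μ := by
    have hid : Integrable (fun x : ℝ => (x : ℂ)) μ := (hmem.integrable one_le_two).ofReal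
    exact (hid.const_mul _).mul_const _
  have hint₂ : Integrable (fun x : ℝ => (t : ℂ) ^ 2 / 2 * ((x ^ 2 : ℝ) : ℂ)) μ :=
    hmem.integrable_sq.ofReal.const_mul _
  have hint₁₂ : Integrable (fun x : ℝ => 1 + t * (x : ℂ) * Complex.I
      - (t : ℂ) ^ 2 / 2 * ((x ^ 2 : ℝ) : ℂ)) μ := ((integrable_const 1).add hint₁).sub hint₂
  have hexp : Integrable (fun x : ℝ => Complex.exp (t * x * Complex.I)) μ :=
    Integrable.of_bound (by fun_prop) 1 (.of_forall fun x => by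
      rw [← Complex.ofReal_mul, Complex.norm_exp_ofReal_mul_I])
  have htaylor : ∫ x : ℝ, (1 + t * (x : ℂ) * Complex.I - (t : ℂ) ^ 2 / 2 * ((x ^ 2 : ℝ) : ℂ)) ∂μ
      = 1 + t * (∫ x, x ∂μ : ℝ) * Complex.I - t ^ 2 / 2 * (∫ x, x ^ 2 ∂μ : ℝ) := by
    have hmean : ∫ x : ℝ, (x : ℂ) ∂μ = (∫ x, x ∂μ : ℝ) := integral_complex_ofReal
    rw [integral_sub (f := fun x : ℝ => 1 + t * (x : ℂ) * Complex.I)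
      ((integrable_const 1).add hint₁) hint₂, integral_add (integrable_const 1) hint₁,
      integral_mul_const, integral_const_mul, integral_const_mul]
    simp only [hmean, integral_complex_ofReal, integral_const, probReal_univ, one_smul]
  rw [← htaylor, charFun_apply_real, ← integral_sub hexp hint₁₂, mul_assoc,
    ← integral_mul_const, ← integral_const_mul]
  refine norm_integral_le_of_norm_le
    (((integrable_rpow_abs_two_add hδ₀ hμ).mul_const _).const_mul _) (.of_forall fun x => ?_)
  have := norm_cexp_mul_I_sub_taylor_le hδ₀ hδ₁ (t * x)
  rw [abs_mul, Real.mul_rpow (abs_nonneg t) (abs_nonneg x), mul_comm (|t| ^ _)] at this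
  refine (le_of_eq (congrArg norm ?_)).trans this
  push_cast
  ring

lemma norm_pow_succ_sub_pow_succ_le {R : Type*} [SeminormedRing R] {a b : R} {r : ℝ}
    (ha : ‖a‖ ≤ r) (hb : ‖b‖ ≤ r) (n : ℕ) :
    ‖a ^ (n + 1) - b ^ (n + 1)‖ ≤ (n + 1) * ‖a - b‖ * r ^ n := by
  have hr : 0 ≤ r := (norm_nonneg _).trans ha
  induction n with
  | zero => simp
  | succ n ih =>
    calc ‖a ^ (n + 1 + 1) - b ^ (n + 1 + 1)‖
        = ‖a * (a ^ (n + 1) - b ^ (n + 1)) + (a - b) * b ^ (n + 1)‖ := by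
          rw [pow_succ' a (n + 1), pow_succ' b (n + 1)]; congr 1; noncomm_ring
      _ ≤ ‖a‖ * ‖a ^ (n + 1) - b ^ (n + 1)‖ + ‖a - b‖ * ‖b‖ ^ (n + 1) :=
          (norm_add_le _ _).trans <| add_le_add (norm_mul_le _ _) <|
            (norm_mul_le _ _).trans (by gcongr; exact norm_pow_le' b n.succ_pos)
      _ ≤ r * ((n + 1) * ‖a - b‖ * r ^ n) + ‖a - b‖ * r ^ (n + 1) := by gcongr
      _ = ((n + 1 : ℕ) + 1) * ‖a - b‖ * r ^ (n + 1) := by push_cast; ring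

lemma norm_exp_neg_sq_div_two_sub_le (hδ₀ : 0 ≤ δ) (hδ₁ : δ ≤ 1) {s : ℝ} (hs : |s| ≤ 1) :
    ‖(Real.exp (-s ^ 2 / 2) : ℂ) - (1 - s ^ 2 / 2)‖ ≤ |s| ^ (2 + δ) := by
  have hsq : s ^ 2 ≤ 1 := (sq_le_one_iff_abs_le_one s).2 hs
  have hnorm : ‖-s ^ 2 / 2‖ = |s| ^ 2 / 2 := by simp
  calc ‖(Real.exp (-s ^ 2 / 2) : ℂ) - (1 - s ^ 2 / 2)‖
      = ‖Real.exp (-s ^ 2 / 2) - 1 - -s ^ 2 / 2‖ := by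
        rw [← Complex.norm_real]; congr 1; push_cast; ring
    _ ≤ ‖-s ^ 2 / 2‖ ^ 2 :=
        Real.norm_exp_sub_one_sub_id_le (by rw [hnorm, sq_abs]; linarith)
    _ = |s| ^ 4 / 4 := by rw [hnorm]; ring
    _ ≤ |s| ^ 3 := by
        linarith [pow_le_pow_of_le_one (abs_nonneg s) hs (by norm_num : 3 ≤ 4),
          pow_nonneg (abs_nonneg s) 4]
    _ ≤ |s| ^ (2 + δ) := pow_three_le_rpow_two_add hδ₀ hδ₁ (abs_nonneg s) hs

lemma norm_sub_exp_neg_sq_div_two_le (hδ₀ : 0 ≤ δ) (hδ₁ : δ ≤ 1) {s : ℝ} {z : ℂ}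
    (hz : ‖z - (1 - s ^ 2 / 2)‖ ≤ A * |s| ^ (2 + δ)) (hs : |s| ≤ 1) :
    ‖z - Real.exp (-s ^ 2 / 2)‖ ≤ (A + 1) * |s| ^ (2 + δ) :=
  calc ‖z - Real.exp (-s ^ 2 / 2)‖
      ≤ ‖z - (1 - s ^ 2 / 2)‖ + ‖(Real.exp (-s ^ 2 / 2) : ℂ) - (1 - s ^ 2 / 2)‖ := by
        rw [norm_sub_rev (Real.exp _ : ℂ)]; exact norm_sub_le_norm_sub_add_norm_sub _ _ _
    _ ≤ A * |s| ^ (2 + δ) + |s| ^ (2 + δ) :=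
        add_le_add hz (norm_exp_neg_sq_div_two_sub_le hδ₀ hδ₁ hs)
    _ = (A + 1) * |s| ^ (2 + δ) := by ring

lemma norm_le_exp_neg_sq_div_four {c s : ℝ} {z : ℂ} (hδ : 0 ≤ δ) (hA : 0 ≤ A)
    (hz : ‖z - (1 - s ^ 2 / 2)‖ ≤ A * |s| ^ (2 + δ)) (hc : c ≤ 1) (hAc : A * c ^ δ ≤ 1 / 4)
    (hs : |s| ≤ c) : ‖z‖ ≤ Real.exp (-s ^ 2 / 4) := by
  have hsq : s ^ 2 ≤ 1 := (sq_le_one_iff_abs_le_one s).2 (hs.trans hc)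
  have hnorm : ‖(1 - s ^ 2 / 2 : ℂ)‖ = 1 - s ^ 2 / 2 := by
    rw [show (1 - s ^ 2 / 2 : ℂ) = ((1 - s ^ 2 / 2 : ℝ) : ℂ) by push_cast; ring, Complex.norm_real,
      Real.norm_of_nonneg (by linarith)]
  have hrem : A * |s| ^ (2 + δ) ≤ s ^ 2 / 4 := by
    calc A * |s| ^ (2 + δ) = s ^ 2 * (A * |s| ^ δ) := by
          rw [Real.rpow_add' (abs_nonneg s) (by linarith), Real.rpow_two, sq_abs]; ring
      _ ≤ s ^ 2 * (A * c ^ δ) := by gcongr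
      _ ≤ s ^ 2 * (1 / 4) := by gcongr
      _ = s ^ 2 / 4 := by ring
  calc ‖z‖ ≤ ‖(1 - s ^ 2 / 2 : ℂ)‖ + ‖z - (1 - s ^ 2 / 2)‖ := norm_le_insert' _ _
    _ ≤ -s ^ 2 / 4 + 1 := by rw [hnorm]; linarith
    _ ≤ Real.exp (-s ^ 2 / 4) := Real.add_one_le_exp _

lemma exists_pos_le_one_mul_rpow_le (hδ : 0 < δ) (hA : 0 ≤ A) :
    ∃ c : ℝ, 0 < c ∧ c ≤ 1 ∧ A * c ^ δ ≤ 1 / 4 := by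
  have hA₄ : 0 < 4 * (A + 1) := by positivity
  refine ⟨(4 * (A + 1))⁻¹ ^ δ⁻¹, by positivity,
    Real.rpow_le_one (by positivity) (inv_le_one_of_one_le₀ (by linarith)) (by positivity), ?_⟩
  rw [Real.rpow_inv_rpow (by positivity) hδ.ne', ← div_eq_mul_inv, div_le_div_iff₀ hA₄ four_pos]
  linarith

lemma natCast_mul_abs_inv_sqrt_mul_rpow {n : ℕ} (hn : n ≠ 0) (δ t : ℝ) :
    (n : ℝ) * |(√n)⁻¹ * t| ^ (2 + δ) = (n : ℝ) ^ (-δ / 2) * |t| ^ (2 + δ) := by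
  have hn₀ : (0 : ℝ) < n := by positivity
  have hpow : ((√n)⁻¹ : ℝ) ^ (2 + δ) = (n : ℝ) ^ (-δ / 2 - 1) := by
    rw [Real.sqrt_eq_rpow, ← Real.rpow_neg hn₀.le, ← Real.rpow_mul hn₀.le]
    congr 1
    ring
  rw [abs_mul, abs_of_nonneg (by positivity), Real.mul_rpow (by positivity) (abs_nonneg t), hpow,
    Real.rpow_sub_one hn₀.ne']
  field_simp

lemma norm_pow_inv_sqrt_mul_sub_exp_le {c t : ℝ} {φ : ℝ → ℂ} (hδ₀ : 0 ≤ δ) (hδ₁ : δ ≤ 1)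
    (hA : 0 ≤ A) (hφ : ∀ s, ‖φ s - (1 - s ^ 2 / 2)‖ ≤ A * |s| ^ (2 + δ)) (hc : c ≤ 1)
    (hAc : A * c ^ δ ≤ 1 / 4) {n : ℕ} (hn : n ≠ 0) (ht : |t| ≤ c * √n) :
    ‖φ ((√n)⁻¹ * t) ^ n - Real.exp (-t ^ 2 / 2)‖
      ≤ 2 * (A + 1) * (n : ℝ) ^ (-δ / 2) * |t| ^ (2 + δ) * Real.exp (-t ^ 2 / 4) := by
  have hsqrt : 0 < √(n : ℝ) := by positivity
  set s : ℝ := (√n)⁻¹ * t with hs_def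
  have hs : |s| ≤ c := by
    rwa [hs_def, abs_mul, abs_of_pos (inv_pos.2 hsqrt), inv_mul_le_iff₀ hsqrt, mul_comm]
  have hns : n * s ^ 2 = t ^ 2 := by
    rw [hs_def, mul_pow, inv_pow, Real.sq_sqrt n.cast_nonneg]; field_simp
  have hexp : (Real.exp (-t ^ 2 / 2) : ℂ) = (Real.exp (-s ^ 2 / 2) : ℂ) ^ n := by
    rw [← Complex.ofReal_pow, ← Real.exp_nat_mul, ← hns]; congr 3; ring
  have hdiff : ‖φ s - Real.exp (-s ^ 2 / 2)‖ ≤ (A + 1) * |s| ^ (2 + δ) :=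
    norm_sub_exp_neg_sq_div_two_le hδ₀ hδ₁ (hφ s) (hs.trans hc)
  have hz : ‖φ s‖ ≤ Real.exp (-s ^ 2 / 4) := norm_le_exp_neg_sq_div_four hδ₀ hA (hφ s) hc hAc hs
  have hw : ‖(Real.exp (-s ^ 2 / 2) : ℂ)‖ ≤ Real.exp (-s ^ 2 / 4) := by
    rw [Complex.norm_real, Real.norm_of_nonneg (Real.exp_pos _).le]
    exact Real.exp_le_exp.2 (by linarith [sq_nonneg s])
  obtain ⟨m, rfl⟩ := Nat.exists_eq_succ_of_ne_zero hn
  have htail : Real.exp (-s ^ 2 / 4) ^ m ≤ 2 * Real.exp (-t ^ 2 / 4) := by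
    have hs₁ : s ^ 2 ≤ 1 := (sq_le_one_iff_abs_le_one s).2 (hs.trans hc)
    calc Real.exp (-s ^ 2 / 4) ^ m = Real.exp (s ^ 2 / 4) * Real.exp (-t ^ 2 / 4) := by
          rw [← Real.exp_nat_mul, ← Real.exp_add, ← hns]; congr 1; push_cast; ring
      _ ≤ 2 * Real.exp (-t ^ 2 / 4) := by
          gcongr
          exact (Real.le_log_iff_exp_le two_pos).1 (by linarith [Real.log_two_gt_d9])
  rw [hexp]
  calc ‖φ s ^ (m + 1) - (Real.exp (-s ^ 2 / 2) : ℂ) ^ (m + 1)‖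
      ≤ (m + 1) * ‖φ s - Real.exp (-s ^ 2 / 2)‖ * Real.exp (-s ^ 2 / 4) ^ m :=
        norm_pow_succ_sub_pow_succ_le hz hw m
    _ ≤ (m + 1) * ((A + 1) * |s| ^ (2 + δ)) * (2 * Real.exp (-t ^ 2 / 4)) := by gcongr
    _ = 2 * (A + 1) * ((m + 1 : ℕ) * |s| ^ (2 + δ)) * Real.exp (-t ^ 2 / 4) := by push_cast; ring
    _ = _ := by rw [natCast_mul_abs_inv_sqrt_mul_rpow hn]; ring

end CharFun

section GaussianSmoothing

variable {v : ℝ≥0}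

lemma charFun_gaussianReal_zero (v : ℝ≥0) (t : ℝ) :
    charFun (gaussianReal 0 v) t = Real.exp (-(v / 2) * t ^ 2) := by
  rw [charFun_gaussianReal]
  push_cast
  ring_nf

lemma integrable_charFun_gaussianReal_zero (hv : v ≠ 0) :
    Integrable (charFun (gaussianReal 0 v)) := by
  simp_rw [funext (charFun_gaussianReal_zero v)]
  exact (integrable_exp_neg_mul_sq (by positivity)).ofReal

lemma gaussianPDFReal_zero_eq_integral_charFun (hv : v ≠ 0) (x : ℝ) :
    (gaussianPDFReal 0 v x : ℂ) = (2 * Real.pi)⁻¹ *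
      ∫ t : ℝ, Complex.exp (t * x * Complex.I) * charFun (gaussianReal 0 v) t := by
  have hfourier := fourierIntegral_gaussian (b := ((v / 2 : ℝ) : ℂ))
    (by rw [Complex.ofReal_re]; positivity) x
  have hconst : ((Real.pi : ℂ) / ((v / 2 : ℝ) : ℂ)) ^ (1 / 2 : ℂ)
      = ((2 * Real.pi * (√(2 * Real.pi * v))⁻¹ : ℝ) : ℂ) := by
    rw [show 2 * Real.pi * (√(2 * Real.pi * v))⁻¹ = (Real.pi / (v / 2)) ^ (1 / 2 : ℝ) by
      rw [← Real.sqrt_eq_rpow, eq_comm, Real.sqrt_eq_iff_eq_sq (by positivity) (by positivity),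
        mul_pow, inv_pow, Real.sq_sqrt (by positivity)]
      field_simp, Complex.ofReal_cpow (by positivity)]
    push_cast
    rfl
  have hexp : Complex.exp (-(x : ℂ) ^ 2 / (4 * ((v / 2 : ℝ) : ℂ)))
      = (Real.exp (-(x - 0) ^ 2 / (2 * v)) : ℂ) := by
    push_cast
    congr 1
    field_simp
    ring
  have hintegrand : ∀ t : ℝ, Complex.exp (t * x * Complex.I) * charFun (gaussianReal 0 v) t
      = Complex.exp (Complex.I * x * t) * Complex.exp (-((v / 2 : ℝ) : ℂ) * t ^ 2) := fun t => by
    rw [charFun_gaussianReal_zero]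
    push_cast
    ring_nf
  simp_rw [hintegrand]
  rw [hfourier, hconst, hexp, gaussianPDFReal_def]
  push_cast
  field_simp

lemma integral_gaussianPDFReal_zero_eq_integral_charFun (hv : v ≠ 0) (κ : Measure ℝ)
    [IsFiniteMeasure κ] :
    ((∫ x, gaussianPDFReal 0 v x ∂κ : ℝ) : ℂ)
      = (2 * Real.pi)⁻¹ * ∫ t, charFun κ t * charFun (gaussianReal 0 v) t := by
  have hswap : Integrable (Function.uncurry fun x t : ℝ =>
      Complex.exp (t * x * Complex.I) * charFun (gaussianReal 0 v) t) (κ.prod volume) := by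
    refine ((integrable_const (1 : ℂ)).mul_prod (integrable_charFun_gaussianReal_zero hv)).mono
      (by unfold Function.uncurry; fun_prop) (.of_forall fun z => ?_)
    rw [Function.uncurry, ← Complex.ofReal_mul, norm_mul, norm_mul, Complex.norm_exp_ofReal_mul_I,
      norm_one]
  rw [← integral_complex_ofReal]
  simp_rw [gaussianPDFReal_zero_eq_integral_charFun hv]
  rw [integral_const_mul, integral_integral_swap hswap]
  simp_rw [integral_mul_const, ← charFun_apply_real]

lemma conv_gaussianReal_zero_apply (hv : v ≠ 0) (ν : Measure ℝ) {B : Set ℝ}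
    (hB : MeasurableSet B) :
    (ν ∗ gaussianReal 0 v) B = ∫⁻ x, gaussianPDF 0 v x ∂(ν ∗ volume.restrict (-B)) := by
  have hmeas := measurable_gaussianPDF 0 v
  rw [← lintegral_indicator_one hB, Measure.lintegral_conv (by fun_prop (disch := exact hB)),
    Measure.lintegral_conv hmeas]
  refine lintegral_congr fun y => ?_
  have hind : Measurable fun z => B.indicator (1 : ℝ → ℝ≥0∞) (y + z) :=
    (measurable_one.indicator hB).comp (measurable_const_add y)
  rw [gaussianReal_of_var_ne_zero _ hv, lintegral_withDensity_eq_lintegral_mul _ hmeas hind,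
    ← lintegral_indicator hB.neg,
    ← lintegral_sub_left_eq_self
      (fun x => (-B).indicator (fun z => gaussianPDF 0 v (y + z)) x) (-y)]
  refine lintegral_congr fun z => ?_
  by_cases hz : y + z ∈ B
  · have hz' : -y - z ∈ -B := by rwa [Set.mem_neg, neg_sub, sub_neg_eq_add, add_comm]
    have hyz : y + (-y - z) = -z := by ring
    simp [hz, hz', gaussianPDF, gaussianPDFReal, hyz]
  · have hz' : -y - z ∉ -B := by rwa [Set.mem_neg, neg_sub, sub_neg_eq_add, add_comm]
    simp [hz, hz']

lemma conv_gaussianReal_zero_real_eq_integral_charFun (hv : v ≠ 0) (ν : Measure ℝ)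
    [IsFiniteMeasure ν] {B : Set ℝ} (hB : MeasurableSet B)
    [IsFiniteMeasure (volume.restrict (-B))] :
    ((ν ∗ gaussianReal 0 v).real B : ℂ) = (2 * Real.pi)⁻¹ *
      ∫ t, charFun ν t * charFun (volume.restrict (-B)) t * charFun (gaussianReal 0 v) t := by
  have hreal : (ν ∗ gaussianReal 0 v).real B
      = ∫ x, gaussianPDFReal 0 v x ∂(ν ∗ volume.restrict (-B)) := by
    rw [Measure.real, conv_gaussianReal_zero_apply hv ν hB, integral_eq_lintegral_of_nonneg_ae
      (.of_forall (gaussianPDFReal_nonneg 0 v))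
      (measurable_gaussianPDFReal 0 v).aestronglyMeasurable]
    rfl
  rw [hreal, integral_gaussianPDFReal_zero_eq_integral_charFun hv]
  simp_rw [charFun_conv]

lemma abs_mul_norm_charFun_volume_restrict_Ico_le (a b t : ℝ) :
    |t| * ‖charFun (volume.restrict (Set.Ico a b)) t‖ ≤ 2 := by
  rcases eq_or_ne t 0 with rfl | ht
  · simp
  rcases lt_or_ge b a with hab | hab
  · simp [Set.Ico_eq_empty_of_le hab.le]
  have hnorm : ∀ u : ℝ, ‖Complex.exp (t * Complex.I * u)‖ = 1 := fun u => by
    rw [mul_right_comm, ← Complex.ofReal_mul, Complex.norm_exp_ofReal_mul_I]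
  have heq : charFun (volume.restrict (Set.Ico a b)) t
      = (Complex.exp (t * Complex.I * b) - Complex.exp (t * Complex.I * a)) / (t * Complex.I) := by
    rw [charFun_apply_real, setIntegral_congr_set Ico_ae_eq_Ioc,
      ← intervalIntegral.integral_of_le hab, ← integral_exp_mul_complex (by simp [ht])]
    simp_rw [mul_right_comm]
  rw [heq, norm_div, norm_mul, Complex.norm_I, mul_one, Complex.norm_real, Real.norm_eq_abs,
    mul_div_cancel₀ _ (abs_ne_zero.2 ht)]
  calc ‖Complex.exp (t * Complex.I * b) - Complex.exp (t * Complex.I * a)‖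
      ≤ ‖Complex.exp (t * Complex.I * b)‖ + ‖Complex.exp (t * Complex.I * a)‖ := norm_sub_le _ _
    _ = 2 := by rw [hnorm, hnorm]; norm_num

lemma abs_conv_gaussianReal_zero_real_Ioc_sub_le (hv : v ≠ 0) (ν ν' : Measure ℝ)
    [IsProbabilityMeasure ν] [IsProbabilityMeasure ν'] {g : ℝ → ℝ} (hg : Integrable g)
    (h : ∀ t, ‖charFun ν t - charFun ν' t‖ * Real.exp (-(v / 2) * t ^ 2) ≤ |t| * g t) (a b : ℝ) :
    |(ν ∗ gaussianReal 0 v).real (Set.Ioc a b) - (ν' ∗ gaussianReal 0 v).real (Set.Ioc a b)|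
      ≤ ∫ t, g t := by
  set κ : Measure ℝ := volume.restrict (-Set.Ioc a b) with hκ
  have hκIco : κ = volume.restrict (Set.Ico (-b) (-a)) := by rw [hκ, Set.neg_Ioc]
  have hfin : IsFiniteMeasure κ := by rw [hκIco]; infer_instance
  have hint : ∀ (ρ : Measure ℝ) [IsProbabilityMeasure ρ], Integrable fun t =>
      charFun ρ t * charFun κ t * charFun (gaussianReal 0 v) t := fun ρ _ => by
    refine (integrable_charFun_gaussianReal_zero hv).bdd_mul (c := κ.real Set.univ)
      (stronglyMeasurable_charFun.mul stronglyMeasurable_charFun).aestronglyMeasurable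
      (.of_forall fun t => ?_)
    rw [norm_mul]
    exact (mul_le_of_le_one_left (norm_nonneg _) (norm_charFun_le_one t)).trans (norm_charFun_le t)
  have hpoint : ∀ᵐ t : ℝ, ‖charFun ν t * charFun κ t * charFun (gaussianReal 0 v) t
      - charFun ν' t * charFun κ t * charFun (gaussianReal 0 v) t‖ ≤ 2 * g t := by
    filter_upwards [compl_mem_ae_iff.2 (measure_singleton (0 : ℝ))] with t ht
    have hκt : |t| * ‖charFun κ t‖ ≤ 2 := by
      rw [hκIco]
      exact abs_mul_norm_charFun_volume_restrict_Ico_le _ _ t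
    have hgt : 0 ≤ g t := nonneg_of_mul_nonneg_right
      ((by positivity : (0 : ℝ) ≤ _).trans (h t)) (abs_pos.2 ht)
    rw [← sub_mul, ← sub_mul, norm_mul, norm_mul, charFun_gaussianReal_zero, Complex.norm_real,
      Real.norm_of_nonneg (Real.exp_nonneg _)]
    calc ‖charFun ν t - charFun ν' t‖ * ‖charFun κ t‖ * Real.exp (-(v / 2) * t ^ 2)
        = ‖charFun ν t - charFun ν' t‖ * Real.exp (-(v / 2) * t ^ 2) * ‖charFun κ t‖ := by ring
      _ ≤ |t| * g t * ‖charFun κ t‖ := mul_le_mul_of_nonneg_right (h t) (norm_nonneg _)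
      _ = |t| * ‖charFun κ t‖ * g t := by ring
      _ ≤ 2 * g t := by gcongr
  have hnorm := norm_integral_le_of_norm_le (hg.const_mul 2) hpoint
  rw [integral_const_mul] at hnorm
  have hpi : (2 * Real.pi)⁻¹ ≤ 2⁻¹ := by
    gcongr
    linarith [Real.two_le_pi]
  rw [← Real.norm_eq_abs, ← Complex.norm_real, Complex.ofReal_sub,
    conv_gaussianReal_zero_real_eq_integral_charFun hv ν measurableSet_Ioc,
    conv_gaussianReal_zero_real_eq_integral_charFun hv ν' measurableSet_Ioc, ← mul_sub,
    ← integral_sub (hint ν) (hint ν'), norm_mul, Complex.norm_real,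
    Real.norm_of_nonneg (by positivity)]
  calc _ ≤ 2⁻¹ * (2 * ∫ t, g t) := mul_le_mul hpi hnorm (norm_nonneg _) (by positivity)
    _ = ∫ t, g t := by ring

lemma measureReal_Ioc_eq_cdf_sub (ν : Measure ℝ) [IsProbabilityMeasure ν] {a b : ℝ}
    (hab : a ≤ b) : ν.real (Set.Ioc a b) = cdf ν b - cdf ν a := by
  rw [cdf_eq_real, cdf_eq_real, ← Set.Iic_sdiff_Iic,
    measureReal_sdiff (Set.Iic_subset_Iic.2 hab) measurableSet_Iic]

lemma abs_cdf_conv_gaussianReal_zero_sub_le (hv : v ≠ 0) (ν ν' : Measure ℝ)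
    [IsProbabilityMeasure ν] [IsProbabilityMeasure ν'] {g : ℝ → ℝ} (hg : Integrable g)
    (h : ∀ t, ‖charFun ν t - charFun ν' t‖ * Real.exp (-(v / 2) * t ^ 2) ≤ |t| * g t) (x : ℝ) :
    |cdf (ν ∗ gaussianReal 0 v) x - cdf (ν' ∗ gaussianReal 0 v) x| ≤ ∫ t, g t := by
  have hlim := (((tendsto_cdf_atBot (ν ∗ gaussianReal 0 v)).const_sub
    (cdf (ν ∗ gaussianReal 0 v) x)).sub ((tendsto_cdf_atBot (ν' ∗ gaussianReal 0 v)).const_sub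
    (cdf (ν' ∗ gaussianReal 0 v) x))).abs
  rw [sub_zero, sub_zero] at hlim
  refine le_of_tendsto hlim ?_
  filter_upwards [Filter.eventually_le_atBot x] with a hax
  rw [← measureReal_Ioc_eq_cdf_sub _ hax, ← measureReal_Ioc_eq_cdf_sub _ hax]
  exact abs_conv_gaussianReal_zero_real_Ioc_sub_le hv ν ν' hg h a x

lemma cdf_conv_eq_integral (ν γ : Measure ℝ) [IsProbabilityMeasure ν] [IsProbabilityMeasure γ]
    (x : ℝ) : cdf (ν ∗ γ) x = ∫ z, cdf ν (x - z) ∂γ := by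
  have hint : Integrable ((Set.Iic x).indicator (1 : ℝ → ℝ)) (γ ∗ ν) :=
    (integrable_const (1 : ℝ)).indicator measurableSet_Iic
  rw [cdf_eq_real, Measure.conv_comm, ← integral_indicator_one measurableSet_Iic,
    integral_conv hint]
  refine integral_congr_ae (.of_forall fun z => ?_)
  have hshift : (fun y => (Set.Iic x).indicator (1 : ℝ → ℝ) (z + y))
      = (Set.Iic (x - z)).indicator 1 := by
    ext y
    simp only [Set.indicator_apply, Set.mem_Iic, le_sub_iff_add_le', Pi.one_apply]
  simp only [hshift, cdf_eq_real]
  exact integral_indicator_one measurableSet_Iic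

lemma integrable_cdf_const_sub (ν γ : Measure ℝ) [IsProbabilityMeasure ν] [IsFiniteMeasure γ]
    (x : ℝ) : Integrable (fun z => cdf ν (x - z)) γ :=
  .of_bound ((monotone_cdf ν).measurable.comp (measurable_const_sub x)).aestronglyMeasurable 1
    (.of_forall fun z => by
      rw [Real.norm_of_nonneg (cdf_nonneg ν _)]
      exact cdf_le_one ν _)

lemma measureReal_mul_sub_le_integral {β : Type*} [MeasurableSpace β] (γ : Measure β)
    [IsProbabilityMeasure γ] {A : Set β} (hA : MeasurableSet A) {s : β → ℝ} (hs : Integrable s γ)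
    {b M : ℝ} (hsA : ∀ z ∈ A, b ≤ s z) (hsM : ∀ z, -M ≤ s z) :
    γ.real A * b - (1 - γ.real A) * M ≤ ∫ z, s z ∂γ := by
  have hAb := setIntegral_ge_of_const_le_real hA (measure_ne_top γ A) hsA hs.integrableOn
  have hAM := setIntegral_ge_of_const_le_real hA.compl (measure_ne_top γ Aᶜ) (fun z _ => hsM z)
    hs.integrableOn
  rw [probReal_compl_eq_one_sub hA] at hAM
  rw [← integral_add_compl hA hs]
  linarith

-- As `D` decreases at rate at most `L`, a large positive value at `x` persists on `[x, x + 2 * r]`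
-- and a large negative one on `[x - 2 * r, x]`, windows that carry most of the smoothing mass.
lemma abs_le_third_add_of_abs_integral_comp_sub_le {D : ℝ → ℝ} {M L B r : ℝ} (hL : 0 ≤ L)
    (hM : ∀ x, |D x| ≤ M) (hD : ∀ x y, x ≤ y → D x - L * (y - x) ≤ D y) (γ : Measure ℝ)
    [IsProbabilityMeasure γ] (hint : ∀ b, Integrable (fun z => D (b - z)) γ)
    (hγ : 3 / 4 ≤ γ.real (Set.Icc (-r) r)) (hB : ∀ b, |∫ z, D (b - z) ∂γ| ≤ B) (x : ℝ) :
    |D x| ≤ M / 3 + (2 * L * r + 4 / 3 * B) := by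
  have hM₀ : 0 ≤ M := (abs_nonneg _).trans (hM 0)
  have hlower : ∀ b s, γ.real (Set.Icc (-r) r) * b - (1 - γ.real (Set.Icc (-r) r)) * M ≤ s →
      s ≤ B → b ≤ M / 3 + 4 / 3 * B := fun b s hbs hsB => by
    rcases le_total b 0 with hb | hb
    · nlinarith [abs_nonneg (∫ z, D (0 - z) ∂γ), hB 0]
    · nlinarith
  refine abs_le'.2 ⟨?_, ?_⟩
  · have hplus := measureReal_mul_sub_le_integral γ (A := Set.Icc (-r) r) measurableSet_Icc
      (hint (x + r))
      (b := D x - 2 * L * r)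
      (fun z hz => by nlinarith [hD x (x + r - z) (by linarith [hz.2]), hz.1])
      fun z => neg_le_of_abs_le (hM _)
    linarith [hlower _ _ hplus (le_of_abs_le (hB _))]
  · have hminus := measureReal_mul_sub_le_integral γ (A := Set.Icc (-r) r) measurableSet_Icc
      (hint (x - r)).neg
      (b := -D x - 2 * L * r)
      (fun z hz => by
        rw [Pi.neg_apply]
        nlinarith [hD (x - r - z) x (by linarith [hz.1]), hz.2])
      fun z => neg_le_neg (le_of_abs_le (hM _))
    simp only [Pi.neg_apply, integral_neg] at hminus
    linarith [hlower _ _ hminus (neg_le.1 (neg_le_of_abs_le (hB (x - r))))]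

lemma abs_le_of_abs_integral_comp_sub_le {D : ℝ → ℝ} {M L B r : ℝ} (hL : 0 ≤ L)
    (hM : ∀ x, |D x| ≤ M) (hD : ∀ x y, x ≤ y → D x - L * (y - x) ≤ D y) (γ : Measure ℝ)
    [IsProbabilityMeasure γ] (hint : ∀ b, Integrable (fun z => D (b - z)) γ)
    (hγ : 3 / 4 ≤ γ.real (Set.Icc (-r) r)) (hB : ∀ b, |∫ z, D (b - z) ∂γ| ≤ B) (x : ℝ) :
    |D x| ≤ 3 * L * r + 2 * B := by
  have hbdd : BddAbove (Set.range fun x => |D x|) := ⟨M, Set.forall_mem_range.2 hM⟩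
  have hle : ∀ x, |D x| ≤ ⨆ y, |D y| := le_ciSup hbdd
  have hsup : ⨆ y, |D y| ≤ (⨆ y, |D y|) / 3 + (2 * L * r + 4 / 3 * B) :=
    ciSup_le (abs_le_third_add_of_abs_integral_comp_sub_le hL hle hD γ hint hγ hB)
  linarith [hle x]

lemma gaussianReal_zero_real_Icc_ge {ε : ℝ} (hε : 0 < ε) :
    3 / 4 ≤ (gaussianReal 0 (ε ^ 2).toNNReal).real (Set.Icc (-(2 * ε)) (2 * ε)) := by
  set γ := gaussianReal 0 (ε ^ 2).toNNReal
  have hchebyshev := meas_ge_le_variance_div_sq (μ := γ) (memLp_id_gaussianReal 2)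
    (c := 2 * ε) (by positivity)
  have hmean : ∫ x, id x ∂γ = 0 := integral_id_gaussianReal
  rw [variance_id_gaussianReal, Real.coe_toNNReal _ (by positivity), hmean,
    show ε ^ 2 / (2 * ε) ^ 2 = 1 / 4 by field_simp; norm_num] at hchebyshev
  have hcompl : γ.real (Set.Icc (-(2 * ε)) (2 * ε))ᶜ ≤ 1 / 4 := by
    refine (measureReal_mono fun z hz => ?_).trans
      (ENNReal.toReal_le_of_le_ofReal (by norm_num) hchebyshev)
    rw [Set.mem_compl_iff, Set.mem_Icc, ← abs_le, not_le] at hz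
    simpa using hz.le
  rw [probReal_compl_eq_one_sub measurableSet_Icc] at hcompl
  linarith

lemma abs_cdf_sub_le_of_charFun (ν ν' : Measure ℝ) [IsProbabilityMeasure ν]
    [IsProbabilityMeasure ν'] {L : ℝ} (hL : 0 ≤ L)
    (hν' : ∀ x y, x ≤ y → cdf ν' y - cdf ν' x ≤ L * (y - x)) {ε : ℝ} (hε : 0 < ε) {g : ℝ → ℝ}
    (hg : Integrable g)
    (h : ∀ t, ‖charFun ν t - charFun ν' t‖ * Real.exp (-(ε ^ 2 / 2) * t ^ 2) ≤ |t| * g t)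
    (x : ℝ) : |cdf ν x - cdf ν' x| ≤ 6 * L * ε + 2 * ∫ t, g t := by
  set v := (ε ^ 2).toNNReal
  have hvε : (v : ℝ) = ε ^ 2 := Real.coe_toNNReal _ (by positivity)
  have hv : v ≠ 0 := (Real.toNNReal_pos.2 (by positivity)).ne'
  have hbound : ∀ y, |cdf ν y - cdf ν' y| ≤ 1 := fun y => abs_sub_le_iff.2
    ⟨by linarith [cdf_le_one ν y, cdf_nonneg ν' y], by linarith [cdf_le_one ν' y, cdf_nonneg ν y]⟩
  have hlip : ∀ y z, y ≤ z → cdf ν y - cdf ν' y - L * (z - y) ≤ cdf ν z - cdf ν' z :=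
    fun y z hyz => by linarith [hν' y z hyz, monotone_cdf ν hyz]
  have hsmooth : ∀ b, |∫ z, (cdf ν (b - z) - cdf ν' (b - z)) ∂gaussianReal 0 v| ≤ ∫ t, g t :=
    fun b => by
      rw [integral_sub (integrable_cdf_const_sub ν _ b) (integrable_cdf_const_sub ν' _ b),
        ← cdf_conv_eq_integral, ← cdf_conv_eq_integral]
      exact abs_cdf_conv_gaussianReal_zero_sub_le hv ν ν' hg (by simpa only [hvε] using h) b
  have hmain := abs_le_of_abs_integral_comp_sub_le hL hbound hlip (gaussianReal 0 v)
    (fun b => (integrable_cdf_const_sub ν _ b).sub (integrable_cdf_const_sub ν' _ b))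
    (gaussianReal_zero_real_Icc_ge hε) hsmooth x
  linarith

lemma abs_cdf_sub_le_of_charFun_of_abs_le (ν ν' : Measure ℝ) [IsProbabilityMeasure ν]
    [IsProbabilityMeasure ν'] {L : ℝ} (hL : 0 ≤ L)
    (hν' : ∀ x y, x ≤ y → cdf ν' y - cdf ν' x ≤ L * (y - x)) {ε T : ℝ} (hε : 0 < ε) (hT : 0 < T)
    {g : ℝ → ℝ} (hg : Integrable g) (hg₀ : 0 ≤ g)
    (h : ∀ t, |t| ≤ T → ‖charFun ν t - charFun ν' t‖ ≤ |t| * g t) (x : ℝ) :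
    |cdf ν x - cdf ν' x| ≤ 6 * L * ε + 2 * ((∫ t, g t) + 2 / T * (√(2 * Real.pi) / ε)) := by
  have hgauss : Integrable fun t : ℝ => 2 / T * Real.exp (-(ε ^ 2 / 2) * t ^ 2) :=
    (integrable_exp_neg_mul_sq (by positivity)).const_mul _
  have hintegral : ∫ t : ℝ, 2 / T * Real.exp (-(ε ^ 2 / 2) * t ^ 2)
      = 2 / T * (√(2 * Real.pi) / ε) := by
    rw [integral_const_mul, integral_gaussian, div_div_eq_mul_div, mul_comm Real.pi,
      Real.sqrt_div (by positivity), Real.sqrt_sq hε.le]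
  rw [← hintegral, ← integral_add hg hgauss]
  refine abs_cdf_sub_le_of_charFun ν ν' hL hν' hε (hg.add hgauss) (fun t => ?_) x
  have hexp : Real.exp (-(ε ^ 2 / 2) * t ^ 2) ≤ 1 := Real.exp_le_one_iff.2 (by
    rw [neg_mul]; exact neg_nonpos.2 (by positivity))
  rw [Pi.add_apply, mul_add]
  rcases le_or_gt |t| T with htT | htT
  · exact (mul_le_of_le_one_right (norm_nonneg _) hexp).trans
      ((h t htT).trans (le_add_of_nonneg_right (by positivity)))
  · have hchar : ‖charFun ν t - charFun ν' t‖ ≤ |t| * (2 / T) := calc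
      ‖charFun ν t - charFun ν' t‖ ≤ ‖charFun ν t‖ + ‖charFun ν' t‖ := norm_sub_le _ _
      _ ≤ 1 + 1 := add_le_add (norm_charFun_le_one t) (norm_charFun_le_one t)
      _ = T * (2 / T) := by field_simp; norm_num
      _ ≤ |t| * (2 / T) := by gcongr
    refine le_add_of_nonneg_of_le (mul_nonneg (abs_nonneg t) (hg₀ t)) ?_
    rw [← mul_assoc]
    gcongr

end GaussianSmoothing

section BerryEsseen

variable {Ω : Type*} [MeasurableSpace Ω] {P : Measure Ω} [IsProbabilityMeasure P] {δ : ℝ}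

lemma Phi_sub_le {x y : ℝ} (hxy : x ≤ y) : Phi y - Phi x ≤ y - x := by
  have hpdf : ∀ z, gaussianPDFReal 0 1 z ≤ 1 := fun z => by
    rw [gaussianPDFReal_def]
    refine mul_le_one₀ (inv_le_one_of_one_le₀ ?_) (Real.exp_nonneg _) (Real.exp_le_one_iff.2 ?_)
    · rw [Real.one_le_sqrt, NNReal.coe_one]
      linarith [Real.two_le_pi]
    · exact div_nonpos_of_nonpos_of_nonneg (neg_nonpos.2 (sq_nonneg _)) (by positivity)
  rw [Phi, Phi, ← measureReal_Ioc_eq_cdf_sub _ hxy, Measure.real,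
    gaussianReal_apply_eq_integral _ one_ne_zero, ENNReal.toReal_ofReal
      (integral_nonneg (gaussianPDFReal_nonneg 0 1)),
    ← Real.norm_of_nonneg (integral_nonneg (gaussianPDFReal_nonneg 0 1))]
  refine (norm_setIntegral_le_of_norm_le_const (C := 1) measure_Ioc_lt_top
    fun z _ => ?_).trans_eq ?_
  · rw [Real.norm_of_nonneg (gaussianPDFReal_nonneg 0 1 z)]
    exact hpdf z
  · rw [one_mul, Real.volume_real_Ioc_of_le hxy]

lemma abs_rpow_two_add_le (hδ₀ : 0 ≤ δ) (hδ₁ : δ ≤ 1) (t : ℝ) :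
    |t| ^ (2 + δ) ≤ |t| * (1 + t ^ 2) := by
  rw [show 2 + δ = 1 + (1 + δ) by ring, Real.rpow_add' (abs_nonneg t) (by linarith), Real.rpow_one,
    ← sq_abs t]
  gcongr
  rcases le_total |t| 1 with ht | ht
  · linarith [Real.rpow_le_one (abs_nonneg t) ht (by linarith : 0 ≤ 1 + δ), sq_nonneg |t|]
  · have hle := Real.rpow_le_rpow_of_exponent_le ht (by linarith : 1 + δ ≤ 2)
    rw [Real.rpow_two] at hle
    linarith

lemma integrable_one_add_sq_mul_exp :
    Integrable fun t : ℝ => (1 + t ^ 2) * Real.exp (-t ^ 2 / 4) := by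
  have hexp : Integrable fun t : ℝ => Real.exp (-4⁻¹ * t ^ 2) :=
    integrable_exp_neg_mul_sq (by norm_num)
  have hsq : Integrable fun t : ℝ => t ^ (2 : ℝ) * Real.exp (-4⁻¹ * t ^ 2) :=
    integrable_rpow_mul_exp_neg_mul_sq (by norm_num) (by norm_num)
  refine (hexp.add hsq).congr (.of_forall fun t => ?_)
  rw [Pi.add_apply, Real.rpow_two, show -4⁻¹ * t ^ 2 = -t ^ 2 / 4 by ring]
  ring

lemma norm_charFun_map_sub_le {Y : Ω → ℝ} (hδ₀ : 0 ≤ δ) (hδ₁ : δ ≤ 1)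
    (hY : MemLp Y (ENNReal.ofReal (2 + δ)) P) (hmean : P[Y] = 0) (hvar : Var[Y; P] = 1) (s : ℝ) :
    ‖charFun (P.map Y) s - (1 - s ^ 2 / 2)‖
      ≤ 4 * (∫ x, |x| ^ (2 + δ) ∂P.map Y) * |s| ^ (2 + δ) := by
  have hYm : AEMeasurable Y P := hY.aemeasurable
  have : IsProbabilityMeasure (P.map Y) := Measure.isProbabilityMeasure_map hYm
  have hfirst : ∫ x, x ∂P.map Y = 0 := by
    rwa [integral_map hYm (by fun_prop)]
  have hsecond : ∫ x, x ^ 2 ∂P.map Y = 1 := by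
    rw [integral_map hYm (by fun_prop), ← variance_of_integral_eq_zero hYm hmean, hvar]
  have hmap : MemLp id (ENNReal.ofReal (2 + δ)) (P.map Y) :=
    (memLp_map_measure_iff aestronglyMeasurable_id hYm).2 hY
  have htaylor := norm_charFun_sub_taylor_le hδ₀ hδ₁ hmap s
  rw [hfirst, hsecond] at htaylor
  simpa using htaylor

lemma one_div_sqrt_le_rpow_mul_rpow {n : ℕ} (hn : n ≠ 0) (hδ : δ ≤ 1 / 2) :
    1 / √n ≤ (n : ℝ) ^ (-δ / 2) * (n : ℝ) ^ (-δ / 2) := by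
  have hn₀ : (0 : ℝ) < n := by positivity
  rw [← Real.rpow_add hn₀, Real.sqrt_eq_rpow, one_div, ← Real.rpow_neg hn₀.le]
  exact Real.rpow_le_rpow_of_exponent_le (by exact_mod_cast Nat.one_le_iff_ne_zero.2 hn)
    (by linarith)

lemma exists_abs_cdf_sum_standardized_sub_Phi_le {Y : ℕ → Ω → ℝ} (hδ₀ : 0 < δ) (hδ₁ : δ ≤ 1 / 2)
    (hindep : iIndepFun Y P) (hident : ∀ i, IdentDistrib (Y i) (Y 0) P P)
    (hY : MemLp (Y 0) (ENNReal.ofReal (2 + δ)) P) (hmean : P[Y 0] = 0) (hvar : Var[Y 0; P] = 1) :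
    ∃ B : ℝ, ∀ n : ℕ, n ≠ 0 → ∀ x : ℝ,
      |cdf (P.map fun ω => (√n)⁻¹ * ∑ k ∈ Finset.range n, Y k ω) x - Phi x|
        ≤ B * (n : ℝ) ^ (-δ / 2) := by
  set A : ℝ := 4 * ∫ x, |x| ^ (2 + δ) ∂P.map (Y 0)
  have hA : 0 ≤ A := mul_nonneg zero_le_four (integral_nonneg fun x => by positivity)
  obtain ⟨c, hc₀, hc₁, hAc⟩ := exists_pos_le_one_mul_rpow_le hδ₀ hA
  set G : ℝ := ∫ t : ℝ, (1 + t ^ 2) * Real.exp (-t ^ 2 / 4)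
  refine ⟨6 + 2 * (2 * (A + 1) * G + 2 / c * √(2 * Real.pi)), fun n hn x => ?_⟩
  have hsum : AEMeasurable (fun ω => (√n)⁻¹ * ∑ k ∈ Finset.range n, Y k ω) P :=
    (Finset.aemeasurable_fun_sum _ fun i _ => (hident i).aemeasurable_fst).const_mul _
  have : IsProbabilityMeasure (P.map fun ω => (√n)⁻¹ * ∑ k ∈ Finset.range n, Y k ω) :=
    Measure.isProbabilityMeasure_map hsum
  set ε : ℝ := (n : ℝ) ^ (-δ / 2)
  have hε : 0 < ε := by positivity
  have hchar : ∀ t, |t| ≤ c * √n →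
      ‖charFun (P.map fun ω => (√n)⁻¹ * ∑ k ∈ Finset.range n, Y k ω) t
        - charFun (gaussianReal 0 1) t‖
      ≤ |t| * (2 * (A + 1) * ε * ((1 + t ^ 2) * Real.exp (-t ^ 2 / 4))) := fun t ht => by
    rw [charFun_inv_sqrt_mul_sum hindep hident, charFun_gaussianReal_zero,
      show -((1 : ℝ≥0) / 2 : ℝ) * t ^ 2 = -t ^ 2 / 2 by push_cast; ring]
    calc _ ≤ 2 * (A + 1) * ε * |t| ^ (2 + δ) * Real.exp (-t ^ 2 / 4) :=
          norm_pow_inv_sqrt_mul_sub_exp_le hδ₀.le (by linarith) hA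
            (norm_charFun_map_sub_le hδ₀.le (by linarith) hY hmean hvar) hc₁ hAc hn ht
      _ ≤ 2 * (A + 1) * ε * (|t| * (1 + t ^ 2)) * Real.exp (-t ^ 2 / 4) := by
          gcongr
          exact abs_rpow_two_add_le hδ₀.le (by linarith) t
      _ = _ := by ring
  have hsmooth := abs_cdf_sub_le_of_charFun_of_abs_le _ (gaussianReal 0 1) zero_le_one
    (fun x y hxy => (Phi_sub_le hxy).trans_eq (one_mul _).symm) hε (T := c * √n) (by positivity)
    (integrable_one_add_sq_mul_exp.const_mul (2 * (A + 1) * ε)) (fun t => by positivity) hchar x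
  rw [integral_const_mul] at hsmooth
  have hcutoff : 2 / (c * √n) * (√(2 * Real.pi) / ε) ≤ 2 / c * √(2 * Real.pi) * ε := calc
    2 / (c * √n) * (√(2 * Real.pi) / ε) = 2 / c * √(2 * Real.pi) * (1 / √n / ε) := by ring
    _ ≤ 2 / c * √(2 * Real.pi) * ε := by
      gcongr
      exact (div_le_iff₀ hε).2 (one_div_sqrt_le_rpow_mul_rpow hn hδ₁)
  exact hsmooth.trans (by linarith)

theorem exists_abs_cdf_sum_sub_Phi_le {Y : ℕ → Ω → ℝ} (hδ₀ : 0 < δ) (hδ₁ : δ ≤ 1 / 2)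
    (hindep : iIndepFun Y P) (hident : ∀ i, IdentDistrib (Y i) (Y 0) P P)
    (hY : MemLp (Y 0) (ENNReal.ofReal (2 + δ)) P) (hvar : Var[Y 0; P] ≠ 0) :
    ∃ B : ℝ, ∀ n : ℕ, n ≠ 0 → ∀ x : ℝ,
      |cdf (P.map fun ω => (√n)⁻¹ * ∑ k ∈ Finset.range n,
          (Y k ω - P[Y 0]) / √(Var[Y 0; P])) x - Phi x| ≤ B * (n : ℝ) ^ (-δ / 2) := by
  set standardize : ℝ → ℝ := fun y => (y - P[Y 0]) / √(Var[Y 0; P])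
  have hmeas : Measurable standardize := by fun_prop
  have hY₂ : MemLp (Y 0) 2 P := hY.mono_exponent
    (ENNReal.ofReal_ofNat 2 ▸ ENNReal.ofReal_le_ofReal (by linarith))
  have hmem : MemLp (fun ω => Y 0 ω - P[Y 0]) (ENNReal.ofReal (2 + δ)) P :=
    hY.sub (memLp_const _)
  refine exists_abs_cdf_sum_standardized_sub_Phi_le (Y := fun k => standardize ∘ Y k) hδ₀ hδ₁
    (hindep.comp _ fun _ => hmeas) (fun i => (hident i).comp hmeas)
    (by simpa only [Function.comp_def, standardize, div_eq_mul_inv] using hmem.mul_const _) ?_ ?_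
  · simp only [Function.comp_def, standardize]
    rw [integral_div, integral_sub (hY₂.integrable one_le_two) (integrable_const _)]
    simp
  · simp only [Function.comp_def, standardize, div_eq_mul_inv]
    rw [variance_mul_const, variance_sub_const hY₂.aestronglyMeasurable, inv_pow,
      Real.sq_sqrt (variance_nonneg _ _), mul_inv_cancel₀ hvar]

lemma abs_real_add_lt_sub_Phi_le {S R : Ω → ℝ} {B ε η : ℝ} (hSm : AEMeasurable S P) (hε : 0 ≤ ε)
    (hS : ∀ x, |cdf (P.map S) x - Phi x| ≤ B) (hR : P.real {ω | ε ≤ |R ω|} ≤ η) (x : ℝ) :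
    |P.real {ω | S ω + R ω < x} - Phi x| ≤ B + ε + η := by
  have : IsProbabilityMeasure (P.map S) := Measure.isProbabilityMeasure_map hSm
  have hcdf : ∀ y, cdf (P.map S) y = P.real {ω | S ω ≤ y} := fun y => by
    rw [cdf_eq_real, map_measureReal_apply_of_aemeasurable hSm measurableSet_Iic]
    rfl
  have hupper : P.real {ω | S ω + R ω < x}
      ≤ P.real {ω | S ω ≤ x + ε} + P.real {ω | ε ≤ |R ω|} := by
    refine (measureReal_mono fun ω hω => ?_).trans (measureReal_union_le _ _)
    refine (le_or_gt ε |R ω|).elim Or.inr fun hRω => Or.inl ?_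
    simp only [Set.mem_ofPred_eq] at hω ⊢
    linarith [(abs_lt.1 hRω).1]
  have hlower : P.real {ω | S ω ≤ x - ε}
      ≤ P.real {ω | S ω + R ω < x} + P.real {ω | ε ≤ |R ω|} := by
    refine (measureReal_mono fun ω hω => ?_).trans (measureReal_union_le _ _)
    refine (le_or_gt ε |R ω|).elim Or.inr fun hRω => Or.inl ?_
    simp only [Set.mem_ofPred_eq] at hω ⊢
    linarith [(abs_lt.1 hRω).2]
  rw [← hcdf] at hupper hlower
  have hPhi_add := Phi_sub_le (show x ≤ x + ε by linarith)
  have hPhi_sub := Phi_sub_le (show x - ε ≤ x by linarith)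
  have hadd := abs_le.1 (hS (x + ε))
  have hsub := abs_le.1 (hS (x - ε))
  exact abs_le.2 ⟨by linarith, by linarith⟩

end BerryEsseen

section KullbackLeibler

/-- The contribution `p * klFun (q / p) = q log (q / p) - q + p` of one letter to the
Kullback–Leibler divergence of `q` from `p`; it is nonnegative, unlike `q log (q / p)`, and is `0`
for `p = 0`. -/
noncomputable def klTerm (q p : ℝ) : ℝ := p * InformationTheory.klFun (q / p)

variable {q p : ℝ}

lemma klTerm_nonneg (hq : 0 ≤ q) (hp : 0 ≤ p) : 0 ≤ klTerm q p :=
  mul_nonneg hp (InformationTheory.klFun_nonneg (div_nonneg hq hp))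

lemma klTerm_eq (h : p = 0 → q = 0) :
    klTerm q p = q * Real.log q - q * Real.log p - q + p := by
  rcases eq_or_ne p 0 with rfl | hp
  · simp [klTerm, h rfl]
  rcases eq_or_ne q 0 with rfl | hq
  · simp [klTerm, InformationTheory.klFun_apply]
  rw [klTerm, InformationTheory.klFun_apply, Real.log_div hq hp]
  field_simp
  ring

lemma klFun_le_sq_sub_one {x : ℝ} (hx : 0 ≤ x) : InformationTheory.klFun x ≤ (x - 1) ^ 2 := by
  rcases hx.eq_or_lt with rfl | hx
  · simp [InformationTheory.klFun_zero]
  rw [InformationTheory.klFun_apply]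
  nlinarith [Real.log_le_sub_one_of_pos hx]

lemma klTerm_le_sq_div (hq : 0 ≤ q) (hp : 0 ≤ p) : klTerm q p ≤ (q - p) ^ 2 / p := by
  rcases hp.eq_or_lt with rfl | hp
  · simp [klTerm]
  calc klTerm q p ≤ p * (q / p - 1) ^ 2 := by
        unfold klTerm; gcongr; exact klFun_le_sq_sub_one (by positivity)
    _ = (q - p) ^ 2 / p := by field_simp

lemma klTerm_le_of_le_one (hq₀ : 0 ≤ q) (hq₁ : q ≤ 1) (hp : p ≠ 0) :
    klTerm q p ≤ -(q * Real.log p) - q + p := by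
  rw [klTerm_eq fun h => absurd h hp]
  linarith [Real.mul_log_nonpos hq₀ hq₁]

lemma measurable_klTerm (p : ℝ) : Measurable fun q => klTerm q p :=
  (InformationTheory.measurable_klFun.comp (measurable_id.div_const p)).const_mul p

end KullbackLeibler

section Letter

variable {Ω α : Type*} [MeasurableSpace Ω] {P : Measure Ω} {a : ℕ+ ≃ α} {p : ℕ+ → ℝ} {Z : Ω → α}

lemma prob_nonneg (hlaw : ∀ i, P.real {ω | Z ω = a i} = p i) (i : ℕ+) : 0 ≤ p i :=
  hlaw i ▸ measureReal_nonneg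

lemma ae_prob_ne_zero [IsFiniteMeasure P] (hlaw : ∀ i, P.real {ω | Z ω = a i} = p i) :
    ∀ᵐ ω ∂P, p (a.symm (Z ω)) ≠ 0 := by
  have hnull : ∀ i, ∀ᵐ ω ∂P, p i = 0 → Z ω ≠ a i := fun i => by
    by_cases hi : p i = 0
    · have : P {ω | Z ω = a i} = 0 := by rw [← measureReal_eq_zero_iff, hlaw i, hi]
      filter_upwards [measure_eq_zero_iff_ae_notMem.1 this] with ω hω _ using hω
    · exact .of_forall fun ω h => absurd h hi
  filter_upwards [ae_all_iff.2 hnull] with ω hω h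
  exact hω _ h (a.apply_symm_apply _).symm

variable [MeasurableSpace α] [MeasurableSingletonClass α]

lemma hasSum_prob_mul (hZ : Measurable Z) (hlaw : ∀ i, P.real {ω | Z ω = a i} = p i)
    {f : ℕ+ → ℝ} (hf : Integrable (fun ω => f (a.symm (Z ω))) P) :
    HasSum (fun i => p i * f i) (∫ ω, f (a.symm (Z ω)) ∂P) := by
  have hms : ∀ i, MeasurableSet {ω | Z ω = a i} := fun i => hZ (measurableSet_singleton _)
  have hdisj : Pairwise (Function.onFun Disjoint fun i => {ω | Z ω = a i}) := fun i j hij =>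
    Set.disjoint_left.2 fun ω (hi : Z ω = a i) hj => hij (a.injective (hi.symm.trans hj))
  have huniv : ⋃ i, {ω | Z ω = a i} = Set.univ :=
    Set.eq_univ_of_forall fun ω => Set.mem_iUnion.2 ⟨a.symm (Z ω), by simp⟩
  have hsum := hasSum_integral_iUnion hms hdisj hf.integrableOn
  rw [huniv, setIntegral_univ] at hsum
  refine hsum.congr_fun fun i => ?_
  have hconst : Set.EqOn (fun ω => f (a.symm (Z ω))) (fun _ => f i) {ω | Z ω = a i} :=
    fun ω (hω : Z ω = a i) => by simp [hω]
  rw [setIntegral_congr_fun (hms i) hconst, setIntegral_const, hlaw i, smul_eq_mul]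

lemma hasSum_prob [IsProbabilityMeasure P] (hZ : Measurable Z)
    (hlaw : ∀ i, P.real {ω | Z ω = a i} = p i) : HasSum p 1 := by
  simpa using hasSum_prob_mul hZ hlaw (f := fun _ => 1) (integrable_const (1 : ℝ))

lemma identDistrib_letter [IsFiniteMeasure P] {Z' : Ω → α} (hZ : Measurable Z)
    (hZ' : Measurable Z') (hlaw : ∀ i, P.real {ω | Z ω = a i} = p i)
    (hlaw' : ∀ i, P.real {ω | Z' ω = a i} = p i) : IdentDistrib Z Z' P P := by
  have : Countable α := a.symm.injective.countable
  refine ⟨hZ.aemeasurable, hZ'.aemeasurable, Measure.ext_iff_singleton.2 fun b => ?_⟩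
  rw [Measure.map_apply hZ (measurableSet_singleton b),
    Measure.map_apply hZ' (measurableSet_singleton b)]
  have h := (hlaw (a.symm b)).trans (hlaw' (a.symm b)).symm
  rw [a.apply_symm_apply] at h
  exact (measureReal_eq_measureReal_iff).1 h

end Letter

section Count

variable {Ω α : Type*} (a : ℕ+ ≃ α) (X : ℕ → Ω → α) (n : ℕ)

open Classical in
lemma cast_count (b : α) (ω : Ω) :
    (count X n b ω : ℝ) = ∑ k ∈ Finset.range n, if X k ω = b then (1 : ℝ) else 0 := by
  simp [count]

lemma count_le (b : α) (ω : Ω) : count X n b ω ≤ n := by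
  classical
  rw [count, Finset.sum_boole]
  simpa using Finset.card_filter_le (Finset.range n) _

lemma exists_of_count_ne_zero {X : ℕ → Ω → α} {n : ℕ} {b : α} {ω : Ω} (h : count X n b ω ≠ 0) :
    ∃ k ∈ Finset.range n, X k ω = b := by
  classical
  obtain ⟨k, hk, hk'⟩ := Finset.exists_ne_zero_of_sum_ne_zero h
  exact ⟨k, hk, by simpa using hk'⟩

lemma finite_count_ne_zero (ω : Ω) : {i | count X n (a i) ω ≠ 0}.Finite := by
  classical
  refine ((Finset.range n).image fun k => a.symm (X k ω)).finite_toSet.subset fun i hi => ?_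
  obtain ⟨k, hk, hki⟩ := exists_of_count_ne_zero hi
  exact Finset.mem_coe.2 (Finset.mem_image.2 ⟨k, hk, by simp [hki]⟩)

lemma phat_nonneg (b : α) (ω : Ω) : 0 ≤ phat X n b ω := by unfold phat; positivity

lemma phat_le_one (b : α) (ω : Ω) : phat X n b ω ≤ 1 :=
  div_le_one_of_le₀ (by exact_mod_cast count_le X n b ω) (by positivity)

lemma phat_eq_inv_mul_sum_indicator (b : α) :
    phat X n b = fun ω => (n : ℝ)⁻¹ * (∑ k ∈ Finset.range n, {ω | X k ω = b}.indicator 1) ω := by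
  classical
  funext ω
  rw [phat, cast_count, div_eq_inv_mul, Finset.sum_apply]
  congr 1

lemma hasSum_phat_mul (f : ℕ+ → ℝ) (ω : Ω) :
    HasSum (fun i => phat X n (a i) ω * f i)
      ((∑ k ∈ Finset.range n, f (a.symm (X k ω))) / n) := by
  classical
  have hletter : ∀ k, HasSum (fun i => if X k ω = a i then f i else 0) (f (a.symm (X k ω))) :=
    fun k => by
      refine (hasSum_ite_eq (a.symm (X k ω)) (f (a.symm (X k ω)))).congr_fun fun i => ?_
      by_cases hi : X k ω = a i
      · simp [hi]
      · have hne : i ≠ a.symm (X k ω) := fun h => hi (by simp [h])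
        simp [hi, hne]
  refine ((hasSum_sum fun k _ => hletter k).div_const (n : ℝ)).congr_fun fun i => ?_
  simp only [phat, cast_count, div_mul_eq_mul_div, Finset.sum_mul, ite_mul, one_mul, zero_mul]

lemma hasSum_phat {n : ℕ} (hn : n ≠ 0) (ω : Ω) : HasSum (fun i => phat X n (a i) ω) 1 := by
  simpa [hn] using hasSum_phat_mul a X n (fun _ => 1) ω

lemma hasSum_phat_mul_log_phat (ω : Ω) :
    HasSum (fun i => phat X n (a i) ω * Real.log (phat X n (a i) ω)) (-plugIn a X n ω) := by
  have hfin : Summable fun i => phat X n (a i) ω * Real.log (phat X n (a i) ω) :=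
    summable_of_hasFiniteSupport ((finite_count_ne_zero a X n ω).subset fun i hi hc => by
      simp [phat, hc] at hi)
  simpa [plugIn, entropy] using hfin.hasSum

variable {a X n} in
lemma hasSum_klTerm_phat {p : ℕ+ → ℝ} (hp : HasSum p 1) (hn : n ≠ 0) {ω : Ω}
    (hω : ∀ i, p i = 0 → count X n (a i) ω = 0) :
    HasSum (fun i => klTerm (phat X n (a i) ω) (p i))
      (-plugIn a X n ω - (∑ k ∈ Finset.range n, logp a p X k ω) / n) := by
  have hsum := (((hasSum_phat_mul_log_phat a X n ω).sub
    (hasSum_phat_mul a X n (fun i => Real.log (p i)) ω)).sub (hasSum_phat a X hn ω)).add hp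
  rw [sub_add_cancel] at hsum
  exact hsum.congr_fun fun i => klTerm_eq fun hi => by simp [phat, hω i hi]

lemma cast_mhat (ω : Ω) :
    (mhat a X n ω : ℝ≥0∞) = ∑' i, if 0 < count X n (a i) ω then (1 : ℝ≥0∞) else 0 := by
  obtain ⟨s, hs⟩ : ∃ s : Finset ℕ+, ∀ i ∉ s, count X n (a i) ω = 0 :=
    ⟨(finite_count_ne_zero a X n ω).toFinset, by simp⟩
  rw [mhat, tsum_eq_sum (s := s) fun i hi => by simp [hs i hi],
    tsum_eq_sum (s := s) fun i hi => by simp [hs i hi]]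
  push_cast
  rfl

variable {a X n} [MeasurableSpace Ω] {P : Measure Ω} {p : ℕ+ → ℝ}

lemma ae_count_eq_zero [IsFiniteMeasure P] (hlaw : ∀ k i, P.real {ω | X k ω = a i} = p i) :
    ∀ᵐ ω ∂P, ∀ i, p i = 0 → count X n (a i) ω = 0 := by
  filter_upwards [ae_all_iff.2 fun k => ae_prob_ne_zero (hlaw k)] with ω hω i hi
  by_contra hc
  obtain ⟨k, -, hk⟩ := exists_of_count_ne_zero hc
  exact hω k (by simpa [hk] using hi)

variable [MeasurableSpace α] [MeasurableSingletonClass α]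

lemma measurable_count (hX : ∀ k, Measurable (X k)) (b : α) : Measurable (count X n b) := by
  classical
  have : count X n b = fun ω => ∑ k ∈ Finset.range n, if X k ω = b then 1 else 0 := by
    funext ω; unfold count; congr
  rw [this]
  exact Finset.measurable_fun_sum _ fun k _ => Measurable.ite
    (hX k (measurableSet_singleton b)) measurable_const measurable_const

lemma measurable_phat (hX : ∀ k, Measurable (X k)) (b : α) : Measurable (phat X n b) :=
  (measurable_from_top.comp (measurable_count hX b) :
    Measurable fun ω => (count X n b ω : ℝ)).div_const _

lemma measurable_ofReal_klTerm_phat (hX : ∀ k, Measurable (X k)) (b : α) (q : ℝ) :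
    Measurable fun ω => ENNReal.ofReal (klTerm (phat X n b ω) q) :=
  ((measurable_klTerm q).comp (measurable_phat hX b)).ennreal_ofReal

lemma measurable_mhat (hX : ∀ k, Measurable (X k)) : Measurable (mhat a X n) :=
  Measurable.tsum fun i =>
    Measurable.ite (measurable_count hX (a i) measurableSet_Ioi) measurable_const measurable_const

lemma measurable_plugIn (hX : ∀ k, Measurable (X k)) : Measurable (plugIn a X n) :=
  (Measurable.tsum fun i =>
    (measurable_phat hX (a i)).mul (Real.measurable_log.comp (measurable_phat hX (a i)))).neg

lemma measurable_logp (hX : ∀ k, Measurable (X k)) (k : ℕ) : Measurable (logp a p X k) := by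
  have : Countable α := a.symm.injective.countable
  exact (measurable_of_countable fun b => Real.log (p (a.symm b))).comp (hX k)

lemma measurable_estimator (hX : ∀ k, Measurable (X k)) : Measurable (estimator a X n) :=
  (measurable_plugIn hX).add (((measurable_from_top.comp (measurable_mhat hX) :
    Measurable fun ω => (mhat a X n ω : ℝ)).sub_const 1).div_const _)

section Expectation

lemma lintegral_ofReal_le_ofReal_integral {f g : Ω → ℝ} (hg : Integrable g P)
    (hg₀ : ∀ ω, 0 ≤ g ω) (hfg : ∀ ω, f ω ≤ g ω) :
    ∫⁻ ω, ENNReal.ofReal (f ω) ∂P ≤ ENNReal.ofReal (∫ ω, g ω ∂P) := by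
  rw [ofReal_integral_eq_lintegral_ofReal hg (.of_forall hg₀)]
  exact lintegral_mono fun ω => ENNReal.ofReal_le_ofReal (hfg ω)

variable [IsProbabilityMeasure P]

lemma integrable_phat (hX : ∀ k, Measurable (X k)) (b : α) : Integrable (phat X n b) P :=
  .of_bound (measurable_phat hX b).aestronglyMeasurable 1 <| .of_forall fun ω => by
    rw [Real.norm_of_nonneg (phat_nonneg X n b ω)]
    exact phat_le_one X n b ω

lemma integral_phat (hX : ∀ k, Measurable (X k)) (hlaw : ∀ k i, P.real {ω | X k ω = a i} = p i)
    (hn : n ≠ 0) (i : ℕ+) : ∫ ω, phat X n (a i) ω ∂P = p i := by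
  have hms : ∀ k, MeasurableSet {ω | X k ω = a i} := fun k => hX k (measurableSet_singleton _)
  have hint : ∀ k, Integrable ({ω | X k ω = a i}.indicator (1 : Ω → ℝ)) P := fun k =>
    (integrable_const (1 : ℝ)).indicator (hms k)
  simp_rw [phat_eq_inv_mul_sum_indicator, Finset.sum_apply]
  rw [integral_const_mul, integral_finsetSum _ fun k _ => hint k]
  simp_rw [integral_indicator_one (hms _), hlaw]
  simp [hn]

lemma variance_indicator_one_le {A : Set Ω} (hA : MeasurableSet A) :
    Var[A.indicator (1 : Ω → ℝ); P] ≤ P.real A := by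
  have hsq : A.indicator (1 : Ω → ℝ) ^ 2 = A.indicator 1 := by
    funext ω
    by_cases h : ω ∈ A <;> simp [h]
  calc Var[A.indicator (1 : Ω → ℝ); P] ≤ P[A.indicator (1 : Ω → ℝ) ^ 2] :=
        variance_le_expectation_sq (measurable_one.indicator hA).aestronglyMeasurable
    _ = P.real A := by rw [hsq, integral_indicator_one hA]

lemma variance_phat_le (hX : ∀ k, Measurable (X k)) (hindep : iIndepFun X P)
    (hlaw : ∀ k i, P.real {ω | X k ω = a i} = p i) (i : ℕ+) :
    Var[phat X n (a i); P] ≤ p i / n := by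
  have hms : ∀ k, MeasurableSet {ω | X k ω = a i} := fun k => hX k (measurableSet_singleton _)
  set Z : ℕ → Ω → ℝ := fun k => {ω | X k ω = a i}.indicator 1
  have hZ : ∀ k, MemLp (Z k) 2 P := fun k => memLp_indicator_const 2 (hms k) 1 (.inr (by simp))
  have hZindep : iIndepFun Z P :=
    hindep.comp (fun _ => ({a i} : Set α).indicator (1 : α → ℝ))
      fun _ => measurable_one.indicator (measurableSet_singleton _)
  have hvar : Var[∑ k ∈ Finset.range n, Z k; P] ≤ n * p i := by
    rw [IndepFun.variance_sum (fun k _ => hZ k) fun j _ k _ hjk => hZindep.indepFun hjk]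
    simpa using Finset.sum_le_card_nsmul _ _ _ fun k (_ : k ∈ Finset.range n) =>
      (variance_indicator_one_le (hms k)).trans_eq (hlaw k i)
  rw [phat_eq_inv_mul_sum_indicator, variance_const_mul]
  calc (n : ℝ)⁻¹ ^ 2 * Var[∑ k ∈ Finset.range n, Z k; P] ≤ (n : ℝ)⁻¹ ^ 2 * (n * p i) := by gcongr
    _ = p i / n := by
        rcases eq_or_ne n 0 with rfl | hn
        · simp
        · field_simp

lemma lintegral_klTerm_le_inv (hX : ∀ k, Measurable (X k)) (hindep : iIndepFun X P)
    (hlaw : ∀ k i, P.real {ω | X k ω = a i} = p i) (hn : n ≠ 0) (i : ℕ+) :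
    ∫⁻ ω, ENNReal.ofReal (klTerm (phat X n (a i) ω) (p i)) ∂P ≤ (n : ℝ≥0∞)⁻¹ := by
  have hp := prob_nonneg (hlaw 0) i
  have hint : Integrable (fun ω => (phat X n (a i) ω - p i) ^ 2) P :=
    (MemLp.of_bound (measurable_phat hX (a i)).aestronglyMeasurable 1 <| .of_forall fun ω => by
      rw [Real.norm_of_nonneg (phat_nonneg X n _ ω)]
      exact phat_le_one X n _ ω : MemLp (phat X n (a i)) 2 P).sub (memLp_const _) |>.integrable_sq
  have hchi : ∫ ω, (phat X n (a i) ω - p i) ^ 2 / p i ∂P ≤ (n : ℝ)⁻¹ := by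
    rw [integral_div, ← integral_phat hX hlaw hn i,
      ← variance_eq_integral (measurable_phat hX _).aemeasurable, integral_phat hX hlaw hn i]
    refine div_le_of_le_mul₀ hp (by positivity) ((variance_phat_le hX hindep hlaw i).trans_eq ?_)
    rw [div_eq_inv_mul]
  calc _ ≤ ENNReal.ofReal (∫ ω, (phat X n (a i) ω - p i) ^ 2 / p i ∂P) :=
        lintegral_ofReal_le_ofReal_integral (hint.div_const _) (fun ω => by positivity)
          fun ω => klTerm_le_sq_div (phat_nonneg X n _ ω) hp
    _ ≤ ENNReal.ofReal (n : ℝ)⁻¹ := ENNReal.ofReal_le_ofReal hchi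
    _ = (n : ℝ≥0∞)⁻¹ := by
        rw [ENNReal.ofReal_inv_of_pos (by positivity), ENNReal.ofReal_natCast]

lemma lintegral_klTerm_le_negMulLog (hX : ∀ k, Measurable (X k))
    (hlaw : ∀ k i, P.real {ω | X k ω = a i} = p i) (hn : n ≠ 0) (i : ℕ+) :
    ∫⁻ ω, ENNReal.ofReal (klTerm (phat X n (a i) ω) (p i)) ∂P
      ≤ ENNReal.ofReal (Real.negMulLog (p i)) := by
  rcases eq_or_ne (p i) 0 with hp | hp
  · simp [klTerm, hp]
  have hlog : Integrable (fun ω => -(phat X n (a i) ω * Real.log (p i))) P :=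
    ((integrable_phat hX (a i)).mul_const _).neg
  have hsub : Integrable (fun ω => -(phat X n (a i) ω * Real.log (p i)) - phat X n (a i) ω) P :=
    hlog.sub (integrable_phat hX (a i))
  have hle : ∀ ω, klTerm (phat X n (a i) ω) (p i)
      ≤ -(phat X n (a i) ω * Real.log (p i)) - phat X n (a i) ω + p i := fun ω =>
    klTerm_le_of_le_one (phat_nonneg X n _ ω) (phat_le_one X n _ ω) hp
  refine (lintegral_ofReal_le_ofReal_integral (hsub.add (integrable_const _)) (fun ω =>
    (klTerm_nonneg (phat_nonneg X n _ ω) (prob_nonneg (hlaw 0) i)).trans (hle ω)) hle).trans_eq ?_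
  rw [integral_add' hsub (integrable_const _), integral_sub hlog (integrable_phat hX _),
    integral_neg, integral_mul_const, integral_phat hX hlaw hn i]
  simp [Real.negMulLog]

lemma lintegral_observed_le (hX : ∀ k, Measurable (X k))
    (hlaw : ∀ k i, P.real {ω | X k ω = a i} = p i) (hn : n ≠ 0) (i : ℕ+) :
    ∫⁻ ω, (if 0 < count X n (a i) ω then (1 : ℝ≥0∞) else 0) ∂P ≤ ENNReal.ofReal (n * p i) := by
  calc _ ≤ ∫⁻ ω, ENNReal.ofReal (n * phat X n (a i) ω) ∂P := by
        refine lintegral_mono fun ω => ?_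
        split_ifs with hcount
        · rw [ENNReal.one_le_ofReal, phat, mul_div_cancel₀ _ (Nat.cast_ne_zero.2 hn)]
          exact_mod_cast hcount
        · exact zero_le
    _ ≤ ENNReal.ofReal (∫ ω, n * phat X n (a i) ω ∂P) :=
        lintegral_ofReal_le_ofReal_integral ((integrable_phat hX (a i)).const_mul _)
          (fun ω => mul_nonneg n.cast_nonneg (phat_nonneg X n _ ω)) fun _ => le_rfl
    _ = _ := by rw [integral_const_mul, integral_phat hX hlaw hn i]

end Expectation

end Count

section TailSum

variable {f g : ℕ+ → ℝ}

lemma summable_tail (hf : Summable f) (k : ℤ) :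
    Summable fun i : ℕ+ => if k ≤ ((i : ℕ) : ℤ) then f i else 0 :=
  (hf.indicator {i : ℕ+ | k ≤ ((i : ℕ) : ℤ)}).congr fun i => by simp [Set.indicator_apply]

lemma tailSum_nonneg (hf : ∀ i, 0 ≤ f i) (k : ℤ) : 0 ≤ tailSum f k :=
  tsum_nonneg fun i => by split_ifs <;> simp [hf]

lemma tailSum_mono (hf : Summable f) (hg : Summable g) (hfg : ∀ i, f i ≤ g i) (k : ℤ) :
    tailSum f k ≤ tailSum g k :=
  (summable_tail hf k).tsum_le_tsum (fun i => by split_ifs <;> simp [hfg]) (summable_tail hg k)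

lemma tailSum_const_mul (f : ℕ+ → ℝ) (c : ℝ) (k : ℤ) :
    tailSum (fun i => c * f i) k = c * tailSum f k := by
  simp only [tailSum, ← tsum_mul_left, mul_ite, mul_zero]

lemma tsum_le_toNat_mul_add_tailSum {F : ℕ+ → ℝ≥0∞} {c : ℝ≥0∞} (hf : Summable f)
    (hf₀ : ∀ i, 0 ≤ f i) (hc : ∀ i, F i ≤ c) (hF : ∀ i, F i ≤ ENNReal.ofReal (f i)) (k : ℤ) :
    ∑' i, F i ≤ k.toNat * c + ENNReal.ofReal (tailSum f k) := by
  have hsplit : ∀ i : ℕ+, F i ≤ (if ((i : ℕ) : ℤ) < k then c else 0)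
      + ENNReal.ofReal (if k ≤ ((i : ℕ) : ℤ) then f i else 0) := fun i => by
    rcases lt_or_ge ((i : ℕ) : ℤ) k with h | h
    · simpa [h, not_le.2 h] using hc i
    · simpa [h, not_lt.2 h] using hF i
  have hhead : ∑' i : ℕ+, (if ((i : ℕ) : ℤ) < k then c else 0) ≤ k.toNat * c :=
    calc _ ≤ ∑' i : ℕ, (if (i : ℤ) < k then c else 0) :=
          ENNReal.tsum_comp_le_tsum_of_injective PNat.coe_injective
            fun i : ℕ => if (i : ℤ) < k then c else 0
      _ = ∑ i ∈ Finset.range k.toNat, (if (i : ℤ) < k then c else 0) :=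
          tsum_eq_sum fun i hi => if_neg (by simp only [Finset.mem_range] at hi; omega)
      _ ≤ k.toNat * c :=
          (Finset.sum_le_card_nsmul _ _ c fun i _ => by split_ifs <;> simp).trans_eq (by simp)
  refine (ENNReal.tsum_le_tsum hsplit).trans ?_
  rw [ENNReal.tsum_add, tailSum, ENNReal.ofReal_tsum_of_nonneg
    (fun i => by split_ifs <;> simp [hf₀]) (summable_tail hf k)]
  gcongr

end TailSum

section Remainder

variable {Ω α : Type*} [MeasurableSpace Ω] {P : Measure Ω} [IsProbabilityMeasure P]
  [MeasurableSpace α] [MeasurableSingletonClass α] {a : ℕ+ ≃ α} {p : ℕ+ → ℝ} {X : ℕ → Ω → α}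
  {n : ℕ}

lemma lintegral_mhat_le (hX : ∀ k, Measurable (X k))
    (hlaw : ∀ k i, P.real {ω | X k ω = a i} = p i) (hn : n ≠ 0) (k : ℤ) :
    ∫⁻ ω, (mhat a X n ω : ℝ≥0∞) ∂P ≤ ENNReal.ofReal (k.toNat + n * tailSum p k) := by
  have hp := prob_nonneg (hlaw 0)
  have hobs : ∀ i, Measurable fun ω => if 0 < count X n (a i) ω then (1 : ℝ≥0∞) else 0 :=
    fun i => Measurable.ite (measurable_count hX (a i) measurableSet_Ioi) measurable_const
      measurable_const
  simp_rw [cast_mhat]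
  rw [lintegral_tsum fun i => (hobs i).aemeasurable]
  refine (tsum_le_toNat_mul_add_tailSum (f := fun i => n * p i) (c := 1)
    ((hasSum_prob (hX 0) (hlaw 0)).summable.mul_left _) (fun i => mul_nonneg n.cast_nonneg (hp i))
    (fun i => ?_) (lintegral_observed_le hX hlaw hn) k).trans_eq ?_
  · calc _ ≤ ∫⁻ _, 1 ∂P := lintegral_mono fun ω => by split_ifs <;> simp
      _ = 1 := by simp
  · rw [tailSum_const_mul, ENNReal.ofReal_add (by positivity)
      (mul_nonneg n.cast_nonneg (tailSum_nonneg hp k)), ENNReal.ofReal_natCast, mul_one]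

lemma lintegral_tsum_klTerm_le (hX : ∀ k, Measurable (X k)) (hindep : iIndepFun X P)
    (hlaw : ∀ k i, P.real {ω | X k ω = a i} = p i) (hn : n ≠ 0)
    (hsum : Summable fun i => Real.negMulLog (p i)) (k : ℤ) :
    ∫⁻ ω, ∑' i, ENNReal.ofReal (klTerm (phat X n (a i) ω) (p i)) ∂P
      ≤ ENNReal.ofReal (k.toNat / n + tailSum (fun i => Real.negMulLog (p i)) k) := by
  have hent : ∀ i, 0 ≤ Real.negMulLog (p i) := fun i =>
    Real.negMulLog_nonneg (prob_nonneg (hlaw 0) i) (hlaw 0 i ▸ measureReal_le_one)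
  rw [lintegral_tsum fun i => (measurable_ofReal_klTerm_phat hX (a i) (p i)).aemeasurable]
  refine (tsum_le_toNat_mul_add_tailSum hsum hent (lintegral_klTerm_le_inv hX hindep hlaw hn)
    (lintegral_klTerm_le_negMulLog hX hlaw hn) k).trans_eq ?_
  rw [ENNReal.ofReal_add (by positivity) (tailSum_nonneg hent k),
    ENNReal.ofReal_div_of_pos (by positivity), ENNReal.ofReal_natCast, ENNReal.ofReal_natCast,
    div_eq_mul_inv]

lemma ae_ofReal_abs_estimator_add_mean_logp_le (hX : ∀ k, Measurable (X k))
    (hlaw : ∀ k i, P.real {ω | X k ω = a i} = p i) (hn : n ≠ 0) :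
    ∀ᵐ ω ∂P, ENNReal.ofReal |estimator a X n ω + (∑ k ∈ Finset.range n, logp a p X k ω) / n|
      ≤ ∑' i, ENNReal.ofReal (klTerm (phat X n (a i) ω) (p i))
        + (mhat a X n ω + 1) * (n : ℝ≥0∞)⁻¹ := by
  have hp := hasSum_prob (hX 0) (hlaw 0)
  filter_upwards [ae_count_eq_zero hlaw] with ω hω
  have hkl := hasSum_klTerm_phat hp hn hω
  have hterm : ∀ i, 0 ≤ klTerm (phat X n (a i) ω) (p i) := fun i =>
    klTerm_nonneg (phat_nonneg X n _ ω) (prob_nonneg (hlaw 0) i)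
  have hcorr : |((mhat a X n ω : ℝ) - 1) / (2 * n)| ≤ (mhat a X n ω + 1) * (n : ℝ)⁻¹ := by
    have hm : (0 : ℝ) ≤ mhat a X n ω := Nat.cast_nonneg _
    rw [abs_div, abs_of_pos (by positivity : (0 : ℝ) < 2 * n), div_le_iff₀ (by positivity)]
    calc |(mhat a X n ω : ℝ) - 1| ≤ 2 * (mhat a X n ω + 1) :=
          abs_le.2 ⟨by linarith [hm], by linarith [hm]⟩
      _ = (mhat a X n ω + 1) * (n : ℝ)⁻¹ * (2 * n) := by field_simp
  have habs : |estimator a X n ω + (∑ k ∈ Finset.range n, logp a p X k ω) / n|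
      ≤ ∑' i, klTerm (phat X n (a i) ω) (p i) + (mhat a X n ω + 1) * (n : ℝ)⁻¹ := by
    have hnonneg := hkl.nonneg hterm
    rw [hkl.tsum_eq, estimator]
    rw [abs_le] at hcorr ⊢
    constructor <;> linarith
  refine (ENNReal.ofReal_le_ofReal habs).trans_eq ?_
  rw [ENNReal.ofReal_add (tsum_nonneg hterm) (by positivity),
    ENNReal.ofReal_tsum_of_nonneg hterm hkl.summable, ENNReal.ofReal_mul (by positivity),
    ENNReal.ofReal_inv_of_pos (by positivity)]
  norm_cast

lemma lintegral_abs_estimator_add_mean_logp_le (hX : ∀ k, Measurable (X k))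
    (hindep : iIndepFun X P) (hlaw : ∀ k i, P.real {ω | X k ω = a i} = p i) (hn : n ≠ 0)
    (hsum : Summable fun i => Real.negMulLog (p i)) (k : ℤ) :
    ∫⁻ ω, ENNReal.ofReal |estimator a X n ω + (∑ k ∈ Finset.range n, logp a p X k ω) / n| ∂P
      ≤ ENNReal.ofReal (2 * (k.toNat / n) + (n : ℝ)⁻¹
        + tailSum (fun i => Real.negMulLog (p i)) k + tailSum p k) := by
  have hent : ∀ i, 0 ≤ Real.negMulLog (p i) := fun i =>
    Real.negMulLog_nonneg (prob_nonneg (hlaw 0) i) (hlaw 0 i ▸ measureReal_le_one)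
  have htail := tailSum_nonneg (prob_nonneg (hlaw 0)) k
  have htail_ent := tailSum_nonneg hent k
  have hkl_meas : Measurable fun ω => ∑' i, ENNReal.ofReal (klTerm (phat X n (a i) ω) (p i)) :=
    Measurable.tsum fun i => measurable_ofReal_klTerm_phat hX (a i) (p i)
  have hmhat_meas : Measurable fun ω => (mhat a X n ω : ℝ≥0∞) :=
    measurable_from_top.comp (measurable_mhat hX)
  refine (lintegral_mono_ae (ae_ofReal_abs_estimator_add_mean_logp_le hX hlaw hn)).trans ?_
  rw [lintegral_add_left hkl_meas, lintegral_mul_const _ (hmhat_meas.add_const 1),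
    lintegral_add_left hmhat_meas, lintegral_const, measure_univ, mul_one]
  refine (add_le_add (lintegral_tsum_klTerm_le hX hindep hlaw hn hsum k) (mul_le_mul_left
    (add_le_add_left (lintegral_mhat_le hX hlaw hn k) 1) _)).trans_eq ?_
  rw [← ENNReal.ofReal_natCast n, ← ENNReal.ofReal_inv_of_pos (by positivity), ← ENNReal.ofReal_one,
    ← ENNReal.ofReal_add (by positivity) one_pos.le, ← ENNReal.ofReal_mul (by positivity),
    ← ENNReal.ofReal_add (by positivity) (by positivity)]
  congr 1
  field_simp
  ring

end Remainder

section Rate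

variable {p : ℕ+ → ℝ} {δ : ℝ} {n : ℕ}

lemma exists_forall_le_mul_negMulLog (hp : HasSum p 1) (hp₀ : ∀ i, 0 ≤ p i)
    (hnonunif : Nonuniform p) : ∃ c, 0 ≤ c ∧ ∀ i, p i ≤ c * Real.negMulLog (p i) := by
  obtain ⟨i, j, hi, hj, hij⟩ := hnonunif
  -- `i ≠ j` both have positive probability, so all probabilities are bounded away from `1`.
  set r := 1 - min (p i) (p j)
  have hpair : ∀ {l m}, l ≠ m → p l ≤ 1 - p m := fun {l m} hlm => by
    have := sum_le_hasSum {l, m} (fun b _ => hp₀ b) hp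
    rw [Finset.sum_pair hlm] at this
    linarith
  have hr : ∀ l, p l ≤ r := fun l => by
    rcases eq_or_ne l i with rfl | hl
    · exact (hpair fun h => hij (congrArg p h)).trans (sub_le_sub_left (min_le_right _ _) 1)
    · exact (hpair hl).trans (sub_le_sub_left (min_le_left _ _) 1)
  have hlog : Real.log r < 0 :=
    Real.log_neg (hi.trans_le (hr i)) (sub_lt_self 1 (lt_min hi hj))
  refine ⟨(-Real.log r)⁻¹, by rw [inv_nonneg]; linarith, fun l => ?_⟩
  rcases (hp₀ l).eq_or_lt with hl | hl
  · simp [← hl]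
  · rw [← div_eq_inv_mul, le_div_iff₀ (by linarith), Real.negMulLog, neg_mul_comm]
    gcongr
    exact hr l

lemma toNat_div_le_rpow (hn : n ≠ 0) {k : ℤ} (hk : (k : ℝ) ≤ (n : ℝ) ^ (1 / 2 - δ)) :
    (k.toNat : ℝ) / n ≤ (n : ℝ) ^ (-(1 / 2 + δ)) := by
  have hn₀ : (0 : ℝ) < n := by positivity
  have htoNat : (k.toNat : ℝ) ≤ (n : ℝ) ^ (1 / 2 - δ) := by
    rcases le_total k 0 with h | h
    · rw [Int.toNat_of_nonpos h, Nat.cast_zero]; positivity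
    · rwa [← Int.cast_natCast, Int.toNat_of_nonneg h]
  calc (k.toNat : ℝ) / n ≤ (n : ℝ) ^ (1 / 2 - δ) / n := by gcongr
    _ = (n : ℝ) ^ (-(1 / 2 + δ)) := by
        rw [← Real.rpow_sub_one hn₀.ne']; congr 1; ring

lemma inv_le_rpow_of_le_half (hn : n ≠ 0) (hδ : δ ≤ 1 / 2) :
    (n : ℝ)⁻¹ ≤ (n : ℝ) ^ (-(1 / 2 + δ)) := by
  rw [← Real.rpow_neg_one]
  exact Real.rpow_le_rpow_of_exponent_le (Nat.one_le_cast.2 (Nat.one_le_iff_ne_zero.2 hn))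
    (by linarith)

end Rate

section MillerMadowEstimator

variable {Ω α : Type*} {a : ℕ+ ≃ α} {p : ℕ+ → ℝ} {X : ℕ → Ω → α} {δ : ℝ} {n : ℕ}

lemma sqrt_mul_estimator_sub_entropy_div (σ : ℝ) (hn : n ≠ 0) (ω : Ω) :
    √n * (estimator a X n ω - entropy p) / σ
      = (√n)⁻¹ * ∑ k ∈ Finset.range n, (-logp a p X k ω - entropy p) / σ
        + √n / σ * (estimator a X n ω + (∑ k ∈ Finset.range n, logp a p X k ω) / n) := by
  have hsqrt : (√(n : ℝ))⁻¹ = √n / n := Real.sqrt_div_self.symm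
  rw [← Finset.sum_div, Finset.sum_sub_distrib, Finset.sum_neg_distrib, hsqrt, Finset.sum_const,
    Finset.card_range, nsmul_eq_mul]
  field_simp
  ring

variable [MeasurableSpace Ω] {P : Measure Ω}

lemma measureReal_le_abs_le_div_of_lintegral_le {R : Ω → ℝ} {ε D : ℝ} (hR : AEMeasurable R P)
    (hε : 0 < ε) (hD : 0 ≤ D) (h : ∫⁻ ω, ENNReal.ofReal |R ω| ∂P ≤ ENNReal.ofReal D) :
    P.real {ω | ε ≤ |R ω|} ≤ D / ε := by
  refine ENNReal.toReal_le_of_le_ofReal (by positivity) ?_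
  rw [ENNReal.ofReal_div_of_pos hε]
  calc P {ω | ε ≤ |R ω|} ≤ P {ω | ENNReal.ofReal ε ≤ ENNReal.ofReal |R ω|} :=
        measure_mono fun ω hω => ENNReal.ofReal_le_ofReal hω
    _ ≤ (∫⁻ ω, ENNReal.ofReal |R ω| ∂P) / ENNReal.ofReal ε :=
        meas_ge_le_lintegral_div (measurable_norm.comp_aemeasurable hR).ennreal_ofReal
          (by simpa using hε) ENNReal.ofReal_ne_top
    _ ≤ _ := by gcongr

lemma measureReal_rpow_le_abs_sqrt_mul_le {R : Ω → ℝ} {σ D : ℝ} (hR : AEMeasurable R P)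
    (hn : n ≠ 0) (hσ : 0 < σ) (hD : 0 ≤ D)
    (h : ∫⁻ ω, ENNReal.ofReal |R ω| ∂P ≤ ENNReal.ofReal (D * (n : ℝ) ^ (-(1 / 2 + δ)))) :
    P.real {ω | (n : ℝ) ^ (-δ / 2) ≤ |√n / σ * R ω|} ≤ D / σ * (n : ℝ) ^ (-δ / 2) := by
  have hn₀ : (0 : ℝ) < n := by positivity
  have hsqrt : 0 < √(n : ℝ) := Real.sqrt_pos.2 hn₀
  have hset : {ω | (n : ℝ) ^ (-δ / 2) ≤ |√n / σ * R ω|}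
      = {ω | (n : ℝ) ^ (-δ / 2) * σ / √n ≤ |R ω|} := by
    ext ω
    rw [Set.mem_ofPred_eq, Set.mem_ofPred_eq, abs_mul,
      abs_of_pos (by positivity : 0 < √(n : ℝ) / σ), div_mul_eq_mul_div, le_div_iff₀ hσ,
      div_le_iff₀' hsqrt]
  have hrate : (n : ℝ) ^ (-(1 / 2 + δ)) = (n : ℝ) ^ (-δ / 2) * (n : ℝ) ^ (-δ / 2) / √n := by
    rw [eq_div_iff hsqrt.ne', Real.sqrt_eq_rpow, ← Real.rpow_add hn₀, ← Real.rpow_add hn₀]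
    congr 1
    ring
  rw [hset]
  refine (measureReal_le_abs_le_div_of_lintegral_le hR (by positivity) (by positivity)
    h).trans_eq ?_
  rw [hrate]
  field_simp

lemma variance_logp_ne_zero [IsProbabilityMeasure P]
    (hlaw : ∀ k i, P.real {ω | X k ω = a i} = p i)
    (hL : MemLp (logp a p X 0) 2 P) (hnonunif : Nonuniform p) : Var[logp a p X 0; P] ≠ 0 := by
  intro hvar
  have hconst := ae_eq_integral_of_variance_eq_zero hL hvar
  have hlog : ∀ i, 0 < p i → Real.log (p i) = ∫ ω, logp a p X 0 ω ∂P := fun i hi => by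
    have hne : P {ω | X 0 ω = a i} ≠ 0 := by
      rw [← measureReal_ne_zero_iff, hlaw 0 i]
      exact hi.ne'
    obtain ⟨ω, hω, hω'⟩ := ((frequently_ae_iff.2 hne).and_eventually hconst).exists
    rw [← hω', logp, hω, a.symm_apply_apply]
  obtain ⟨i, j, hi, hj, hij⟩ := hnonunif
  exact hij (Real.log_injOn_pos hi hj ((hlog i hi).trans (hlog j hj).symm))

variable [MeasurableSpace α] [MeasurableSingletonClass α]

lemma memLp_logp (hX : ∀ k, Measurable (X k)) {r : ℝ} (hr : 0 < r)
    (hmoment : Integrable (fun ω => |logp a p X 0 ω| ^ r) P) :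
    MemLp (logp a p X 0) (ENNReal.ofReal r) P := by
  rw [← integrable_norm_rpow_iff (measurable_logp hX 0).aestronglyMeasurable (by simpa using hr)
    ENNReal.ofReal_ne_top, ENNReal.toReal_ofReal hr.le]
  exact hmoment

lemma hasSum_prob_mul_log (hX : ∀ k, Measurable (X k))
    (hlaw : ∀ k i, P.real {ω | X k ω = a i} = p i) (hint : Integrable (logp a p X 0) P) :
    HasSum (fun i => p i * Real.log (p i)) (∫ ω, logp a p X 0 ω ∂P) :=
  hasSum_prob_mul (hX 0) (hlaw 0) (f := fun i => Real.log (p i)) hint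

variable [IsProbabilityMeasure P]

lemma exists_lintegral_abs_estimator_add_mean_logp_le (hX : ∀ k, Measurable (X k))
    (hindep : iIndepFun X P) (hlaw : ∀ k i, P.real {ω | X k ω = a i} = p i)
    (hnonunif : Nonuniform p) (hsum : Summable fun i => p i * Real.log (p i)) (hδ : δ ≤ 1 / 2)
    {K : ℕ → ℤ} {C : ℝ} (hK : ∀ n : ℕ, 1 ≤ n → (K n : ℝ) ≤ (n : ℝ) ^ (1 / 2 - δ))
    (hent : ∀ n : ℕ, 1 ≤ n →
      -(n : ℝ) ^ (1 / 2 + δ) * tailSum (fun i => p i * Real.log (p i)) (K n) ≤ C) :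
    ∃ D, 0 ≤ D ∧ ∀ n : ℕ, n ≠ 0 →
      ∫⁻ ω, ENNReal.ofReal |estimator a X n ω + (∑ k ∈ Finset.range n, logp a p X k ω) / n| ∂P
        ≤ ENNReal.ofReal (D * (n : ℝ) ^ (-(1 / 2 + δ))) := by
  have hp := hasSum_prob (hX 0) (hlaw 0)
  obtain ⟨c, hc₀, hc⟩ := exists_forall_le_mul_negMulLog hp (prob_nonneg (hlaw 0)) hnonunif
  have hsum' : Summable fun i => Real.negMulLog (p i) :=
    hsum.neg.congr fun i => (neg_mul _ _).symm
  have htail_neg : ∀ k, tailSum (fun i => Real.negMulLog (p i)) k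
      = -tailSum (fun i => p i * Real.log (p i)) k := fun k => by
    simpa only [Real.negMulLog, neg_mul, one_mul] using
      tailSum_const_mul (fun i => p i * Real.log (p i)) (-1) k
  have htail_ent : ∀ n : ℕ, n ≠ 0 → tailSum (fun i => Real.negMulLog (p i)) (K n)
      ≤ max C 0 * (n : ℝ) ^ (-(1 / 2 + δ)) := fun n hn => by
    have hn₀ : (0 : ℝ) < n := by positivity
    rw [htail_neg, Real.rpow_neg hn₀.le, ← div_eq_mul_inv, le_div_iff₀' (by positivity)]
    linarith [hent n (Nat.one_le_iff_ne_zero.2 hn), le_max_left C 0]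
  have htail_prob : ∀ k, tailSum p k ≤ c * tailSum (fun i => Real.negMulLog (p i)) k := fun k =>
    (tailSum_mono hp.summable (hsum'.mul_left c) hc k).trans_eq (tailSum_const_mul _ _ _)
  refine ⟨3 + (1 + c) * max C 0, by positivity, fun n hn => ?_⟩
  refine (lintegral_abs_estimator_add_mean_logp_le hX hindep hlaw hn hsum' (K n)).trans
    (ENNReal.ofReal_le_ofReal ?_)
  have hhead := toNat_div_le_rpow hn (hK n (Nat.one_le_iff_ne_zero.2 hn))
  have hinv := inv_le_rpow_of_le_half hn hδ
  have hmass := (htail_prob (K n)).trans (mul_le_mul_of_nonneg_left (htail_ent n hn) hc₀)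
  linarith [htail_ent n hn]

lemma exists_abs_cdf_sum_neg_logp_sub_Phi_le (hX : ∀ k, Measurable (X k))
    (hindep : iIndepFun X P) (hlaw : ∀ k i, P.real {ω | X k ω = a i} = p i) (hδ₀ : 0 < δ)
    (hδ₁ : δ ≤ 1 / 2) (hL : MemLp (logp a p X 0) (ENNReal.ofReal (2 + δ)) P)
    (hvar : Var[logp a p X 0; P] ≠ 0) :
    ∃ B, ∀ n : ℕ, n ≠ 0 → ∀ x, |cdf (P.map fun ω => (√n)⁻¹ * ∑ k ∈ Finset.range n,
      (-logp a p X k ω - entropy p) / √(Var[logp a p X 0; P])) x - Phi x|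
        ≤ B * (n : ℝ) ^ (-δ / 2) := by
  have : Countable α := a.symm.injective.countable
  have hmeas : Measurable fun b => -Real.log (p (a.symm b)) := measurable_of_countable _
  have hint : Integrable (logp a p X 0) P := hL.integrable (by
    rw [← ENNReal.ofReal_one]
    exact ENNReal.ofReal_le_ofReal (by linarith))
  have hmean : entropy p = ∫ ω, -logp a p X 0 ω ∂P := by
    rw [entropy, (hasSum_prob_mul_log hX hlaw hint).tsum_eq, integral_neg]
  rw [← variance_fun_neg] at hvar
  simp only [hmean, ← variance_fun_neg (X := logp a p X 0)]
  exact exists_abs_cdf_sum_sub_Phi_le (Y := fun k ω => -logp a p X k ω) hδ₀ hδ₁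
    (hindep.comp _ fun _ => hmeas)
    (fun i => (identDistrib_letter (hX i) (hX 0) (hlaw i) (hlaw 0)).comp hmeas) hL.neg hvar

end MillerMadowEstimator

end MillerMadow

open MillerMadow in
theorem theorem3p2_general {Ω α : Type*} [MeasurableSpace Ω] (μ : Measure Ω)
    [IsProbabilityMeasure μ] [MeasurableSpace α] [MeasurableSingletonClass α] (a : ℕ+ ≃ α)
    (p : ℕ+ → ℝ) (X : ℕ → Ω → α)
    (hmeas : ∀ k, Measurable (X k)) (hindep : iIndepFun X μ)
    (hlaw : ∀ k i, μ.real {ω | X k ω = a i} = p i)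
    (hnonunif : Nonuniform p)
    (δ : ℝ) (hδ : 0 < δ) (hδ' : δ ≤ 1 / 2)
    (hmoment : Integrable (fun ω => |logp a p X 0 ω| ^ (2 + δ)) μ)
    (K : ℕ → ℤ) (C : ℝ)
    (hK : ∀ n : ℕ, 1 ≤ n → (K n : ℝ) ≤ (n : ℝ) ^ (1 / 2 - δ))
    (hent : ∀ n : ℕ, 1 ≤ n →
      -(n : ℝ) ^ (1 / 2 + δ) * tailSum (fun i => p i * Real.log (p i)) (K n) ≤ C) :
    ∃ C' : ℝ, ∀ n : ℕ, 1 ≤ n → ∀ x : ℝ,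
      |μ.real {ω | √n * (estimator a X n ω - entropy p) / √(Var[logp a p X 0; μ]) < x} - Phi x|
        ≤ C' * (n : ℝ) ^ (-δ / 2) := by
  have hL := memLp_logp hmeas (by linarith) hmoment
  have hL₂ : MemLp (logp a p X 0) 2 μ := hL.mono_exponent
    (ENNReal.ofReal_ofNat 2 ▸ ENNReal.ofReal_le_ofReal (by linarith))
  have hvar := variance_logp_ne_zero hlaw hL₂ hnonunif
  have hσ := Real.sqrt_pos.2 ((variance_nonneg _ _).lt_of_ne' hvar)
  have hsum := (hasSum_prob_mul_log hmeas hlaw (hL₂.integrable one_le_two)).summable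
  obtain ⟨B, hB⟩ := exists_abs_cdf_sum_neg_logp_sub_Phi_le hmeas hindep hlaw hδ hδ' hL hvar
  obtain ⟨D, hD₀, hD⟩ := exists_lintegral_abs_estimator_add_mean_logp_le hmeas hindep hlaw
    hnonunif hsum hδ' hK hent
  set σ := √(Var[logp a p X 0; μ])
  refine ⟨B + 1 + D / σ, fun n hn x => ?_⟩
  have hn₀ : n ≠ 0 := Nat.one_le_iff_ne_zero.1 hn
  have hlogp : ∀ k, Measurable (logp a p X k) := measurable_logp hmeas
  have hR : Measurable fun ω =>
      estimator a X n ω + (∑ k ∈ Finset.range n, logp a p X k ω) / n := by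
    have := measurable_estimator (a := a) (n := n) hmeas
    fun_prop
  have hS : Measurable fun ω => (√n)⁻¹ * ∑ k ∈ Finset.range n,
      (-logp a p X k ω - entropy p) / σ := by fun_prop
  have hR_small := measureReal_rpow_le_abs_sqrt_mul_le hR.aemeasurable hn₀ hσ hD₀ (hD n hn₀)
  simp_rw [sqrt_mul_estimator_sub_entropy_div (p := p) σ hn₀]
  refine (abs_real_add_lt_sub_Phi_le hS.aemeasurable (by positivity) (hB n hn₀) hR_small
    x).trans_eq ?_
  ring

theorem theorem3p2 {Ω α : Type*} [MeasurableSpace Ω] (μ : Measure Ω) [IsProbabilityMeasure μ]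
    [MeasurableSpace α] [MeasurableSingletonClass α] (a : ℕ+ ≃ α)
    (p : ℕ+ → ℝ) (X : ℕ → Ω → α)
    (hmeas : ∀ k, Measurable (X k)) (hindep : iIndepFun X μ)
    (hlaw : ∀ k i, μ.real {ω | X k ω = a i} = p i)
    (hnonunif : MillerMadow.Nonuniform p)
    (δ : ℝ) (hδ : 0 < δ) (hδ' : δ < 1 / 2)
    (hmoment : Integrable (fun ω => |MillerMadow.logp a p X 0 ω| ^ (2 + δ)) μ)
    (K : ℕ → ℤ) (C : ℝ)
    (hK : ∀ n : ℕ, 1 ≤ n → (K n : ℝ) ≤ (n : ℝ) ^ (1 / 2 - δ))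
    (htail : ∀ n : ℕ, 1 ≤ n →
      (n : ℝ) ^ (1 / 2 + δ) * Real.log n * MillerMadow.tailSum p (K n) ≤ C)
    (hent : ∀ n : ℕ, 1 ≤ n →
      -(n : ℝ) ^ (1 / 2 + δ) * MillerMadow.tailSum (fun i => p i * Real.log (p i)) (K n) ≤ C) :
    ∃ C' : ℝ, ∀ n : ℕ, 1 ≤ n → ∀ x : ℝ,
      |μ.real {ω | √n * (MillerMadow.estimator a X n ω - MillerMadow.entropy p)
            / √(Var[MillerMadow.logp a p X 0; μ]) < x} - MillerMadow.Phi x|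
        ≤ C' * (n : ℝ) ^ (-δ / 2) :=
  theorem3p2_general μ a p X hmeas hindep hlaw hnonunif δ hδ hδ'.le hmoment K C hK hent
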